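/- Let $\Gamma$ be a rooted metric tree with root $o$, whose edges are compact intervals of positive length, such that exactly one edge emanates from $o$ and at least two edges emanate (away from the root) from every other vertex. For $x\in\Gamma$ let $|x|$ be the length of the path from $o$ to $x$, and let the branching number $b(x)$ be the number of edges emanating from $x$ if $x$ is a vertex and $b(x)=1$ otherwise. Assume that $\Gamma$ is regular, i.e. $b(x)=b(y)$ whenever $|x|=|y|$, and that it has dimension $d\in(1,2]$, i.e. its branching function $g_\Gamma(t)=\#\{x\in\Gamma : |x|=t\}$ satisfies, with constants $C_1,C_2>0$, $$C_1(1+t)^{d-1}\le g_\Gamma(t)\le C_2(1+t)^{d-1},\qquad t\ge 0 .$$ Put $E^+=C_1/C_2$ and $E^-=C_2/C_1$. Let $H^1(\Gamma)$ be the space of continuous $f\colon\Gamma\to\mathbb C$ in $L^2(\Gamma)$ that are absolutely continuous on every edge with $f'\in L^2(\Gamma)$, and let the Neumann Laplacian $-\Delta_\Gamma$ be the self-adjoint operator in $L^2(\Gamma)$ associated with the closed quadratic form $\int_\Gamma|f'|^2\,dx$ with domain $H^1(\Gamma)$. Let $V$ be a bounded, nonnegative, measurable function on $(0,\infty)$ and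 put $\tilde V(x)=V(|x|)$ for $x\in\Gamma$ (the value at the root is irrelevant). For $\alpha>0$ let $H_\alpha^\pm$ be the self-adjoint operator in $L^2((0,\infty),(1+t)^{d-1}dt)$ associated with the closed quadratic form $$h_\alpha^\pm[u]=\int_0^\infty\bigl(|u'(t)|^2-\alpha E^\pm V(t)|u(t)|^2\bigr)(1+t)^{d-1}\,dt,$$ with domain $\{u : u,u'\in L^2((0,\infty),(1+t)^{d-1}dt)\}$. Then, for every $\alpha>0$ with $\inf\operatorname{spec}(H_\alpha^+)<0$, $$\inf\operatorname{spec}(H_\alpha^-)\le\inf\operatorname{spec}(-\Delta_\Gamma-\alpha\tilde V)\le\inf\operatorname{spec}(H_\alpha^+).$$ -/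

import Mathlib

open MeasureTheory Set
open scoped ENNReal

noncomputable section

namespace TreeSchrodinger

universe u

/-! ## Sesquilinear forms, associated operators and their spectra -/

section Forms

variable {H : Type*} [NormedAddCommGroup H] [InnerProductSpace ℂ H]

/-- A sesquilinear form (conjugate linear in the first argument) with domain a subspace of `H`. -/
structure SesqForm (H : Type*) [NormedAddCommGroup H] [InnerProductSpace ℂ H] where
  /-- the form domain -/
  domain : Submodule ℂ H
  /-- the form, whose quadratic form is `u ↦ toFun u u` -/
  toFun : domain →ₗ⋆[ℂ] domain →ₗ[ℂ] ℂ

/-- The graph of the operator associated with a form `h`: the pairs `(u, w)` such that `u` is in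
the form domain and `h(v, u) = ⟨v, w⟩` for all `v` in the form domain. -/
def SesqForm.operatorGraph (h : SesqForm H) : Submodule ℂ (H × H) where
  carrier := {p | ∃ hu : p.1 ∈ h.domain, ∀ v : h.domain, h.toFun v ⟨p.1, hu⟩ = inner ℂ (v : H) p.2}
  zero_mem' := ⟨h.domain.zero_mem, fun v => by
    have : (⟨(0 : H × H).1, h.domain.zero_mem⟩ : h.domain) = 0 := rfl
    rw [this]; simp⟩
  add_mem' := by
    rintro p q ⟨hp, hp'⟩ ⟨hq, hq'⟩
    refine ⟨h.domain.add_mem hp hq, fun v => ?_⟩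
    have : (⟨(p + q).1, h.domain.add_mem hp hq⟩ : h.domain) = ⟨p.1, hp⟩ + ⟨q.1, hq⟩ := rfl
    rw [this, map_add, hp', hq', Prod.snd_add, inner_add_right]
  smul_mem' := by
    rintro c p ⟨hp, hp'⟩
    refine ⟨h.domain.smul_mem c hp, fun v => ?_⟩
    have : (⟨(c • p).1, h.domain.smul_mem c hp⟩ : h.domain) = c • ⟨p.1, hp⟩ := rfl
    rw [this, map_smul, hp', Prod.smul_snd, inner_smul_right, smul_eq_mul]

/-- The operator associated with a (densely defined) form. -/
def SesqForm.operator (h : SesqForm H) : H →ₗ.[ℂ] H := h.operatorGraph.toLinearPMap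

/-- The resolvent set of an unbounded operator `T`: those `z` for which `T - z` maps the domain
of `T` bijectively onto `H` with bounded inverse `R`. -/
def pmapResolventSet (T : H →ₗ.[ℂ] H) : Set ℂ :=
  {z | ∃ R : H →L[ℂ] H,
    (∀ f : H, ∃ hf : R f ∈ T.domain, T ⟨R f, hf⟩ - z • R f = f) ∧
    ∀ x : T.domain, R (T x - z • (x : H)) = x}

/-- The spectrum of an unbounded operator. -/
def pmapSpectrum (T : H →ₗ.[ℂ] H) : Set ℂ := (pmapResolventSet T)ᶜ

/-- The infimum of the (real) spectrum, as an extended real number: it is `⊥` if the spectrum is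
unbounded from below and `⊤` if it is empty. -/
def infSpec (T : H →ₗ.[ℂ] H) : EReal := ⨅ x : {x : ℝ // (x : ℂ) ∈ pmapSpectrum T}, ((x : ℝ) : EReal)

end Forms

/-! ## Energy forms and Schrödinger forms on `L²` spaces -/

section L2

variable {X : Type*} [MeasurableSpace X] {μ : Measure X}

/-- Multiplication by a real function `W ∈ L^∞(μ)`, as an operator on `L²(μ)`. -/
def mulOp (W : X → ℝ) (hW : MemLp W ∞ μ) : Lp ℂ 2 μ →ₗ[ℂ] Lp ℂ 2 μ where
  toFun φ := ((Lp.memLp φ).mul (p := ∞) hW.ofReal : MemLp (fun x => (W x : ℂ) * φ x) 2 μ).toLp _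
  map_add' φ ψ := by
    ext1
    filter_upwards [MemLp.coeFn_toLp ((Lp.memLp (φ + ψ)).mul (p := ∞) (r := 2) hW.ofReal),
      MemLp.coeFn_toLp ((Lp.memLp φ).mul (p := ∞) (r := 2) hW.ofReal),
      MemLp.coeFn_toLp ((Lp.memLp ψ).mul (p := ∞) (r := 2) hW.ofReal), Lp.coeFn_add φ ψ,
      Lp.coeFn_add (((Lp.memLp φ).mul (p := ∞) (r := 2) hW.ofReal).toLp _)
        (((Lp.memLp ψ).mul (p := ∞) (r := 2) hW.ofReal).toLp _)] with x h1 h2 h3 h4 h5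
    refine h1.trans (Eq.trans ?_ h5.symm)
    rw [Pi.add_apply, h2, h3, Pi.mul_apply, h4]
    simp [mul_add]
  map_smul' c φ := by
    ext1
    filter_upwards [MemLp.coeFn_toLp ((Lp.memLp (c • φ)).mul (p := ∞) (r := 2) hW.ofReal),
      MemLp.coeFn_toLp ((Lp.memLp φ).mul (p := ∞) (r := 2) hW.ofReal), Lp.coeFn_smul c φ,
      Lp.coeFn_smul c (((Lp.memLp φ).mul (p := ∞) (r := 2) hW.ofReal).toLp _)] with x h1 h2 h3 h4
    refine h1.trans (Eq.trans ?_ h4.symm)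
    rw [Pi.smul_apply, h2, Pi.mul_apply, h3]
    simp [mul_left_comm]

/-- The energy form `(u, v) ↦ ∫ conj(u') v' dμ` of a derivative operator `u ↦ u' = D u` on
`L²(μ)`. -/
def energyForm (D : Lp ℂ 2 μ →ₗ.[ℂ] Lp ℂ 2 μ) : SesqForm (Lp ℂ 2 μ) where
  domain := D.domain
  toFun := LinearMap.mk₂'ₛₗ _ _ (fun φ ψ => inner ℂ (D φ) (D ψ))
    (by intros; simp [LinearPMap.map_add, inner_add_left])
    (by intros; simp [LinearPMap.map_smul, inner_smul_left])
    (by intros; simp [LinearPMap.map_add, inner_add_right])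
    (by intros; simp [LinearPMap.map_smul, inner_smul_right])

/-- The Schrödinger form `(u, v) ↦ ∫ (conj(u') v' - W conj(u) v) dμ` of a derivative operator
`u ↦ u' = D u` on `L²(μ)` and a bounded real function `W`. -/
def schrodingerForm (D : Lp ℂ 2 μ →ₗ.[ℂ] Lp ℂ 2 μ) (W : X → ℝ) (hW : MemLp W ∞ μ) :
    SesqForm (Lp ℂ 2 μ) where
  domain := D.domain
  toFun := LinearMap.mk₂'ₛₗ _ _
    (fun φ ψ => inner ℂ (D φ) (D ψ) - inner ℂ (φ : Lp ℂ 2 μ) (mulOp W hW ψ))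
    (by intros; simp [LinearPMap.map_add, inner_add_left]; ring)
    (by intros; simp [LinearPMap.map_smul, inner_smul_left, mul_sub])
    (by intros; simp [LinearPMap.map_add, inner_add_right]; ring)
    (by intros; simp [LinearPMap.map_smul, inner_smul_right, mul_sub])

/-- The quadratic form of `schrodingerForm` is `u ↦ ∫ (|u'|² - W |u|²) dμ`. -/
theorem schrodingerForm_self (D : Lp ℂ 2 μ →ₗ.[ℂ] Lp ℂ 2 μ) (W : X → ℝ) (hW : MemLp W ∞ μ)
    (φ : D.domain) :
    (schrodingerForm D W hW).toFun φ φ =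
      ((∫ x, (‖D φ x‖ ^ 2 - W x * ‖(φ : Lp ℂ 2 μ) x‖ ^ 2) ∂μ : ℝ) : ℂ) := by
  change inner ℂ (D φ) (D φ) - inner ℂ (φ : Lp ℂ 2 μ) (mulOp W hW φ) = _
  rw [L2.inner_def, L2.inner_def, ← integral_sub (L2.integrable_inner _ _)
    (L2.integrable_inner _ _), ← integral_complex_ofReal]
  refine integral_congr_ae ?_
  filter_upwards [MemLp.coeFn_toLp ((Lp.memLp (φ : Lp ℂ 2 μ)).mul (p := ∞) (r := 2) hW.ofReal)]
    with x hx
  have hx' : (mulOp W hW φ : Lp ℂ 2 μ) x = (W x : ℂ) * (φ : Lp ℂ 2 μ) x := hx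
  rw [hx', inner_self_eq_norm_sq_to_K]
  simp only [RCLike.inner_apply, Complex.ofReal_sub, Complex.ofReal_mul, Complex.ofReal_pow]
  rw [mul_assoc, RCLike.mul_conj]
  rfl

end L2

/-- `f` is absolutely continuous on `[a, b]`, with derivative `f'` almost everywhere. -/
def HasACDeriv (f f' : ℝ → ℂ) (a b : ℝ) : Prop :=
  IntervalIntegrable f' volume a b ∧ ∀ t ∈ Icc a b, f t = f a + ∫ s in a..t, f' s

theorem HasACDeriv.zero (a b : ℝ) : HasACDeriv (fun _ => 0) (fun _ => 0) a b :=
  ⟨by simp, fun t _ => by simp⟩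

theorem HasACDeriv.add {f f' g g' : ℝ → ℂ} {a b : ℝ} (hf : HasACDeriv f f' a b)
    (hg : HasACDeriv g g' a b) :
    HasACDeriv (fun t => f t + g t) (fun t => f' t + g' t) a b := by
  refine ⟨hf.1.add hg.1, fun t ht => ?_⟩
  have hs : uIcc a t ⊆ uIcc a b := by
    rw [uIcc_of_le ht.1, uIcc_of_le (ht.1.trans ht.2)]
    exact Icc_subset_Icc_right ht.2
  rw [intervalIntegral.integral_add (hf.1.mono_set hs) (hg.1.mono_set hs)]
  beta_reduce
  rw [hf.2 t ht, hg.2 t ht]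
  ring

theorem HasACDeriv.const_mul {f f' : ℝ → ℂ} {a b : ℝ} (c : ℂ) (hf : HasACDeriv f f' a b) :
    HasACDeriv (fun t => c * f t) (fun t => c * f' t) a b := by
  refine ⟨hf.1.const_mul c, fun t ht => ?_⟩
  rw [intervalIntegral.integral_const_mul]
  beta_reduce
  rw [hf.2 t ht]
  ring

/-- The standing assumptions on the potential, a function on `(0, ∞)`: values of `V` outside
`(0, ∞)` are irrelevant. -/
structure IsBoundedPotential (V : ℝ → ℝ) : Prop where
  measurable : Measurable fun t : Ioi (0 : ℝ) => V t
  nonneg : ∀ t, 0 < t → 0 ≤ V t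
  bounded : ∃ M, ∀ t, 0 < t → V t ≤ M

theorem IsBoundedPotential.measurable_indicator {V : ℝ → ℝ} (hV : IsBoundedPotential V) :
    Measurable ((Ioi (0 : ℝ)).indicator V) := by
  have h := (MeasurableEmbedding.subtype_coe (measurableSet_Ioi (a := (0 : ℝ)))).measurable_extend
    hV.measurable (measurable_const (a := (0 : ℝ)))
  convert! h using 1
  ext t
  by_cases ht : t ∈ Ioi (0 : ℝ)
  · rw [indicator_of_mem ht]
    exact (Subtype.val_injective.extend_apply (fun s : Ioi (0 : ℝ) => V s) (fun _ => (0 : ℝ)) ⟨t, ht⟩).symm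
  · rw [indicator_of_notMem ht, Function.extend_apply']
    rintro ⟨a, rfl⟩
    exact ht a.2

theorem IsBoundedPotential.exists_norm_le {V : ℝ → ℝ} (hV : IsBoundedPotential V) :
    ∃ M, ∀ t, ‖(Ioi (0 : ℝ)).indicator V t‖ ≤ M := by
  obtain ⟨M, hM⟩ := hV.bounded
  refine ⟨max M 0, fun t => ?_⟩
  by_cases ht : 0 < t
  · rw [indicator_of_mem (by exact ht), Real.norm_of_nonneg (hV.nonneg t ht)]
    exact (hM t ht).trans (le_max_left _ _)
  · rw [indicator_of_notMem (by exact ht)]; simp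

/-! ## The half-line operators -/

/-- The measure `(1 + t)^(d - 1) dt` on `(0, ∞)`. -/
def halfLineMeasure (d : ℝ) : Measure ℝ :=
  (volume.restrict (Ioi 0)).withDensity fun t => ENNReal.ofReal ((1 + t) ^ (d - 1))

/-- The graph of the weak derivative in `L²((0, ∞), (1 + t)^(d - 1) dt)`: the pairs `(u, u')` of
elements of this space such that `u` is locally absolutely continuous on `(0, ∞)`, with derivative
`u'`. -/
def halfLineDerivGraph (d : ℝ) :
    Submodule ℂ (Lp ℂ 2 (halfLineMeasure d) × Lp ℂ 2 (halfLineMeasure d)) where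
  carrier := {p | ∃ f f' : ℝ → ℂ, p.1 =ᵐ[halfLineMeasure d] f ∧ p.2 =ᵐ[halfLineMeasure d] f' ∧
    ∀ a b : ℝ, 0 < a → a < b → HasACDeriv f f' a b}
  zero_mem' := ⟨fun _ => 0, fun _ => 0, Lp.coeFn_zero _ _ _, Lp.coeFn_zero _ _ _,
    fun a b _ _ => HasACDeriv.zero a b⟩
  add_mem' := by
    rintro p q ⟨f, f', h1, h2, h3⟩ ⟨g, g', k1, k2, k3⟩
    exact ⟨fun t => f t + g t, fun t => f' t + g' t, (Lp.coeFn_add p.1 q.1).trans (h1.add k1),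
      (Lp.coeFn_add p.2 q.2).trans (h2.add k2), fun a b ha hb => (h3 a b ha hb).add (k3 a b ha hb)⟩
  smul_mem' := by
    rintro c p ⟨f, f', h1, h2, h3⟩
    exact ⟨fun t => c * f t, fun t => c * f' t, (Lp.coeFn_smul c p.1).trans (h1.const_smul c),
      (Lp.coeFn_smul c p.2).trans (h2.const_smul c), fun a b ha hb => (h3 a b ha hb).const_mul c⟩

/-- The weak derivative in `L²((0, ∞), (1 + t)^(d - 1) dt)`, with domain the Sobolev space
`H¹((0, ∞), (1 + t)^(d - 1) dt)`. -/
def halfLineDeriv (d : ℝ) : Lp ℂ 2 (halfLineMeasure d) →ₗ.[ℂ] Lp ℂ 2 (halfLineMeasure d) :=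
  (halfLineDerivGraph d).toLinearPMap

theorem IsBoundedPotential.memLp_halfLine {V : ℝ → ℝ} (hV : IsBoundedPotential V) (d c : ℝ) :
    MemLp (fun t => c * V t) ∞ (halfLineMeasure d) := by
  obtain ⟨M, hM⟩ := hV.exists_norm_le
  refine MemLp.const_mul ?_ c
  have h : MemLp ((Ioi (0 : ℝ)).indicator V) ∞ (halfLineMeasure d) :=
    memLp_top_of_bound hV.measurable_indicator.aestronglyMeasurable M (ae_of_all _ hM)
  refine h.ae_eq ?_
  refine (withDensity_absolutelyContinuous _ _).ae_eq ?_
  exact indicator_ae_eq_restrict measurableSet_Ioi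

/-- The operator in `L²((0, ∞), (1 + t)^(d - 1) dt)` associated with the form
`u ↦ ∫ (|u'|² - c V |u|²) (1 + t)^(d - 1) dt` on `H¹((0, ∞), (1 + t)^(d - 1) dt)`. -/
def halfLineOperator (d : ℝ) (V : ℝ → ℝ) (hV : IsBoundedPotential V) (c : ℝ) :
    Lp ℂ 2 (halfLineMeasure d) →ₗ.[ℂ] Lp ℂ 2 (halfLineMeasure d) :=
  (schrodingerForm (halfLineDeriv d) (fun t => c * V t) (hV.memLp_halfLine d c)).operator

/-! ## Rooted metric trees -/

/-- The combinatorial data of a rooted metric tree: every vertex `v ≠ root` is joined to its parent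
by an edge, an interval of length `len v > 0`. The values of `len` at the root are irrelevant. -/
structure MetricTree where
  /-- the set of vertices -/
  Vert : Type u
  /-- the root -/
  root : Vert
  /-- the parent of a vertex, where the root is its own parent by convention -/
  parent : Vert → Vert
  parent_root : parent root = root
  exists_iterate : ∀ v, ∃ n : ℕ, parent^[n] v = root
  /-- the length of the edge from `parent v` to `v` -/
  len : Vert → ℝ
  len_pos : ∀ v, v ≠ root → 0 < len v

namespace MetricTree

variable (Γ : MetricTree.{u})

open scoped Classical in
/-- The number of edges between a vertex and the root. -/
def level (v : Γ.Vert) : ℕ := Nat.find (Γ.exists_iterate v)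

/-- The length of the path from the root to the vertex `v`. -/
def height (v : Γ.Vert) : ℝ := ∑ i ∈ Finset.range (Γ.level v), Γ.len (Γ.parent^[i] v)

theorem level_root : Γ.level Γ.root = 0 := by
  classical
  simp [level]

theorem height_root : Γ.height Γ.root = 0 := by simp [height, level_root]

theorem level_eq {v : Γ.Vert} (hv : v ≠ Γ.root) : Γ.level v = Γ.level (Γ.parent v) + 1 := by
  classical
  unfold level
  exact Nat.find_comp_succ (Γ.exists_iterate v) (Γ.exists_iterate (Γ.parent v)) hv

theorem height_eq {v : Γ.Vert} (hv : v ≠ Γ.root) :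
    Γ.height v = Γ.height (Γ.parent v) + Γ.len v := by
  simp [height, level_eq Γ hv, Finset.sum_range_succ']

/-- The edges, labelled by their endpoint further away from the root. -/
abbrev Edge : Type u := {v : Γ.Vert // v ≠ Γ.root}

/-- The pair `(v, t)` stands for a point of the tree: either it is the root, or it is the point at
distance `t` from the root on the edge from `parent v` (excluded) to `v` (included). -/
def IsPoint (p : Σ _ : Γ.Vert, ℝ) : Prop :=
  (p.1 = Γ.root ∧ p.2 = 0) ∨
    (p.1 ≠ Γ.root ∧ p.2 ∈ Ioc (Γ.height (Γ.parent p.1)) (Γ.height p.1))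

/-- The points of the metric tree. -/
def Point : Type u := {p : Σ _ : Γ.Vert, ℝ // Γ.IsPoint p}

/-- A set of points is measurable if its intersection with every edge is. -/
instance : MeasurableSpace Γ.Point := inferInstanceAs (MeasurableSpace (Subtype Γ.IsPoint))

variable {Γ} in
/-- The distance `|x|` of a point `x` to the root. -/
def Point.abs (x : Γ.Point) : ℝ := x.1.2

theorem isPoint_vert (v : Γ.Vert) : Γ.IsPoint ⟨v, Γ.height v⟩ := by
  by_cases hv : v = Γ.root
  · exact Or.inl ⟨hv, by simp [hv, height_root]⟩
  · exact Or.inr ⟨hv, by have := Γ.height_eq hv; have := Γ.len_pos v hv; simp; linarith⟩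

/-- A vertex, as a point of the tree. -/
def vertPoint (v : Γ.Vert) : Γ.Point := ⟨⟨v, Γ.height v⟩, Γ.isPoint_vert v⟩

open scoped Classical in
/-- The parametrization of the closed edge from `parent v` to `v` by the distance to the root,
`t ∈ [|parent v|, |v|]`; at `t = |parent v|` its value is the vertex `parent v`. (The values for
other `t` are irrelevant.) -/
def edgePoint (e : Γ.Edge) (t : ℝ) : Γ.Point :=
  ⟨if t ∈ Ioc (Γ.height (Γ.parent e.1)) (Γ.height e.1) then ⟨e.1, t⟩
    else (Γ.vertPoint (Γ.parent e.1)).1, by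
      split_ifs with h
      · exact Or.inr ⟨e.2, h⟩
      · exact (Γ.vertPoint (Γ.parent e.1)).2⟩

/-- The number of edges emanating from a vertex (in the direction away from the root). -/
def numChildren (v : Γ.Vert) : ℕ∞ := {w : Γ.Vert | w ≠ Γ.root ∧ Γ.parent w = v}.encard

open scoped Classical in
/-- The branching number `b(x)`: the number of edges emanating from `x` if `x` is a vertex, and
one if `x` is an interior point of an edge. -/
def branching (x : Γ.Point) : ℕ∞ :=
  if x.abs = Γ.height x.1.1 then Γ.numChildren x.1.1 else 1

/-- Exactly one edge emanates from the root and at least two from every other vertex. -/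
def IsProper : Prop :=
  Γ.branching (Γ.vertPoint Γ.root) = 1 ∧
    ∀ v : Γ.Vert, v ≠ Γ.root → 1 < Γ.branching (Γ.vertPoint v)

/-- A tree is regular if the branching number of a point depends only on its distance to the
root. -/
def IsRegular : Prop := ∀ x y : Γ.Point, x.abs = y.abs → Γ.branching x = Γ.branching y

/-- The branching function `g(t) = #{x : |x| = t}`. (Its value is zero if this set is infinite.) -/
def branchingFun (t : ℝ) : ℕ := {x : Γ.Point | x.abs = t}.ncard

/-- The Lebesgue measure on the tree: the sum of the Lebesgue measures on its edges. -/
def vol : Measure Γ.Point :=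
  Measure.sum fun e : Γ.Edge =>
    (volume.restrict (Icc (Γ.height (Γ.parent e.1)) (Γ.height e.1))).map (Γ.edgePoint e)

/-- The graph of the derivative on the tree: the pairs `(u, u')` of elements of `L²(Γ)` such that
`u` is continuous on the tree (its restrictions to the closed edges are continuous, and agree at
the vertices) and absolutely continuous on each closed edge, with derivative `u'`. -/
def derivGraph : Submodule ℂ (Lp ℂ 2 Γ.vol × Lp ℂ 2 Γ.vol) where
  carrier := {p | ∃ f f' : Γ.Point → ℂ, p.1 =ᵐ[Γ.vol] f ∧ p.2 =ᵐ[Γ.vol] f' ∧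
    ∀ e : Γ.Edge, HasACDeriv (fun t => f (Γ.edgePoint e t)) (fun t => f' (Γ.edgePoint e t))
      (Γ.height (Γ.parent e.1)) (Γ.height e.1)}
  zero_mem' := ⟨fun _ => 0, fun _ => 0, Lp.coeFn_zero _ _ _, Lp.coeFn_zero _ _ _,
    fun _ => HasACDeriv.zero _ _⟩
  add_mem' := by
    rintro p q ⟨f, f', h1, h2, h3⟩ ⟨g, g', k1, k2, k3⟩
    exact ⟨fun t => f t + g t, fun t => f' t + g' t, (Lp.coeFn_add p.1 q.1).trans (h1.add k1),
      (Lp.coeFn_add p.2 q.2).trans (h2.add k2), fun e => (h3 e).add (k3 e)⟩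
  smul_mem' := by
    rintro c p ⟨f, f', h1, h2, h3⟩
    exact ⟨fun t => c * f t, fun t => c * f' t, (Lp.coeFn_smul c p.1).trans (h1.const_smul c),
      (Lp.coeFn_smul c p.2).trans (h2.const_smul c), fun e => (h3 e).const_mul c⟩

/-- The derivative in `L²(Γ)`, with domain the Sobolev space `H¹(Γ)`. -/
def deriv : Lp ℂ 2 Γ.vol →ₗ.[ℂ] Lp ℂ 2 Γ.vol := Γ.derivGraph.toLinearPMap

/-- The Neumann Laplacian `-Δ_Γ`, the operator in `L²(Γ)` associated with the form
`u ↦ ∫ |u'|²` on `H¹(Γ)`. -/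
def neumannLaplacian : Lp ℂ 2 Γ.vol →ₗ.[ℂ] Lp ℂ 2 Γ.vol := (energyForm Γ.deriv).operator

theorem measurable_abs : Measurable (Point.abs : Γ.Point → ℝ) := by
  have h : Measurable (fun p : Σ _ : Γ.Vert, ℝ => p.2) :=
    measurable_iff_comap_le.2 <| by
      rintro _ ⟨s, hs, rfl⟩
      exact MeasurableSpace.measurableSet_iInf.2 fun a => hs
  exact h.comp measurable_subtype_coe

theorem measurable_edgePoint (e : Γ.Edge) : Measurable (Γ.edgePoint e) := by
  classical
  refine Measurable.subtype_mk (Measurable.ite measurableSet_Ioc ?_ measurable_const)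
  exact measurable_iff_comap_le.2 <| by
    rintro _ ⟨s, hs, rfl⟩
    exact MeasurableSpace.measurableSet_iInf.1 hs e.1

theorem ae_abs_pos : ∀ᵐ x ∂Γ.vol, 0 < x.abs := by
  have hm : MeasurableSet {x : Γ.Point | 0 < x.abs} := Γ.measurable_abs measurableSet_Ioi
  refine (Measure.ae_sum_iff' hm).2 fun e => ?_
  rw [ae_map_iff (Γ.measurable_edgePoint e).aemeasurable hm, ← restrict_Ioc_eq_restrict_Icc]
  filter_upwards [ae_restrict_mem measurableSet_Ioc] with t ht
  have hn : ∀ v, 0 ≤ Γ.height v := fun v => by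
    refine Finset.sum_nonneg fun i hi => (Γ.len_pos _ ?_).le
    classical
    exact Nat.find_min (Γ.exists_iterate v) (Finset.mem_range.1 hi)
  have : (Γ.edgePoint e t).abs = t := by simp only [Point.abs, edgePoint, if_pos ht]
  rw [this]
  exact (hn _).trans_lt ht.1

theorem memLp_radial {V : ℝ → ℝ} (hV : IsBoundedPotential V) (α : ℝ) :
    MemLp (fun x : Γ.Point => α * V x.abs) ∞ Γ.vol := by
  obtain ⟨M, hM⟩ := hV.exists_norm_le
  refine MemLp.const_mul ?_ α
  have h : MemLp (fun x : Γ.Point => (Ioi (0 : ℝ)).indicator V x.abs) ∞ Γ.vol :=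
    memLp_top_of_bound (hV.measurable_indicator.comp Γ.measurable_abs).aestronglyMeasurable M
      (ae_of_all _ fun x => hM _)
  refine h.ae_eq ?_
  filter_upwards [Γ.ae_abs_pos] with x hx
  exact indicator_of_mem (by exact hx) V

/-- The Schrödinger operator `-Δ_Γ - α Ṽ` in `L²(Γ)`, where `Ṽ(x) = V(|x|)`. -/
def schrodingerOperator (V : ℝ → ℝ) (hV : IsBoundedPotential V) (α : ℝ) :
    Lp ℂ 2 Γ.vol →ₗ.[ℂ] Lp ℂ 2 Γ.vol :=
  Γ.neumannLaplacian -
    (mulOp (fun x : Γ.Point => α * V x.abs) (Γ.memLp_radial hV α)).toPMap ⊤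

end MetricTree

end TreeSchrodinger

end

open TreeSchrodinger

open scoped ENNReal

/-! A real number `l` lies below the spectrum of a Schrödinger operator exactly when `l‖u‖²` is a
lower bound for its quadratic form (`le_infSpec_iff`). The theorem therefore reduces to carrying
form bounds with negative `l` from the tree to the half-line and back.

From tree to half-line, test with radial functions `u(|x|)`. Integrals over the tree become
integrals against the branching function. Bound it above by `C₂(1+t)^(d-1)` in the terms with
`|u'|²` and `|u|²`, and below by `C₁(1+t)^(d-1)` in the potential term. Division by `C₂` leaves the
coupling `α C₁/C₂`. The norm term is estimated in the right direction because `l < 0`. This is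
`halfLine_bound_of_tree_bound`.

From half-line to tree, replace `f` by its root mean square `φ(t)` over the sphere of radius `t`.
With the branching function as weight, this preserves the integrals of `|f|²` and of `V|f|²`. The
triangle inequality for vectors of values on a sphere gives `|φ'| ≤` root mean square of `f'`, so
the energy does not increase. The two constants now change roles, which gives `α C₂/C₁`. This is
`tree_bound_of_halfLine_bound`. Regularity enters when a level of vertices is crossed: all its
vertices have the same number of children, so the spherical mean does not jump (`sphereAvg_eq`).

The variational principle needs the derivative to be closed, single-valued and densely defined. The
first two are proved for tree and half-line at once, by viewing both as spaces covered by curves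
(`IsCurveDerivGraph`). -/

namespace TreeSchrodinger

open MeasureTheory Set Filter Topology

/-! ### Abstract variational principle for the bottom of the spectrum -/

section Abstract

variable {H : Type*} [NormedAddCommGroup H] [InnerProductSpace ℂ H] [CompleteSpace H]

/-- A derivative graph inside the Hilbert space `H ⊕ H`. -/
abbrev hilbertGraph (G : Submodule ℂ (H × H)) : Submodule ℂ (WithLp 2 (H × H)) :=
  G.comap (WithLp.linearEquiv 2 ℂ (H × H)).toLinearMap

theorem completeSpace_hilbertGraph {G : Submodule ℂ (H × H)} (hG : IsClosed (G : Set (H × H))) :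
    CompleteSpace (hilbertGraph G) := by
  have : IsClosed (hilbertGraph G : Set (WithLp 2 (H × H))) :=
    hG.preimage (WithLp.prodContinuousLinearEquiv 2 ℂ H H).continuous
  exact this.completeSpace_coe

/-- Lax–Milgram on the graph with its Hilbert norm. With `i` and `δ` the two coordinate maps, the
form shifted by `m` is represented by `B = δ*δ - i*(W + m)i`. It is coercive for `m < l`, and the
resolvent is `i B⁻¹ i*`. -/
theorem mem_pmapResolventSet_of_lt {G : Submodule ℂ (H × H)} (hG : IsClosed (G : Set (H × H)))
    (W : H →L[ℂ] H) (T : H →ₗ.[ℂ] H)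
    (hT : ∀ u w, (u, w) ∈ T.graph ↔ ∃ u', (u, u') ∈ G ∧
      ∀ q ∈ G, inner ℂ q.2 u' - inner ℂ q.1 (W u) = inner ℂ q.1 w)
    {l m : ℝ} (hl : ∀ p ∈ G, l * ‖p.1‖ ^ 2 ≤ ‖p.2‖ ^ 2 - (inner ℂ p.1 (W p.1)).re)
    (hm : m < l) : (m : ℂ) ∈ pmapResolventSet T := by
  have := completeSpace_hilbertGraph hG
  let L := (WithLp.prodContinuousLinearEquiv 2 ℂ H H).toContinuousLinearMap ∘L
    (hilbertGraph G).subtypeL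
  let i : hilbertGraph G →L[ℂ] H := ContinuousLinearMap.fst ℂ H H ∘L L
  let δ : hilbertGraph G →L[ℂ] H := ContinuousLinearMap.snd ℂ H H ∘L L
  let A : H →L[ℂ] H := W + (m : ℂ) • ContinuousLinearMap.id ℂ H
  let B : hilbertGraph G →L[ℂ] hilbertGraph G :=
    ContinuousLinearMap.adjoint δ ∘L δ - ContinuousLinearMap.adjoint i ∘L A ∘L i
  have hmem : ∀ x : hilbertGraph G, (i x, δ x) ∈ G := fun x => x.2
  have hnorm : ∀ x : hilbertGraph G, ‖x‖ ^ 2 = ‖i x‖ ^ 2 + ‖δ x‖ ^ 2 := fun x =>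
    WithLp.prod_norm_sq_eq_of_L2 (x : WithLp 2 (H × H))
  have hB : ∀ x y, inner ℂ y (B x) =
      inner ℂ (δ y) (δ x) - inner ℂ (i y) (W (i x)) - m * inner ℂ (i y) (i x) := by
    intro x y
    change inner ℂ y (ContinuousLinearMap.adjoint δ (δ x) - ContinuousLinearMap.adjoint i
      (W (i x) + (m : ℂ) • i x)) = _
    rw [inner_sub_right, ContinuousLinearMap.adjoint_inner_right,
      ContinuousLinearMap.adjoint_inner_right, inner_add_right, inner_smul_right]
    ring
  have hself : ∀ x, (inner ℂ x (B x)).re =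
      ‖δ x‖ ^ 2 - (inner ℂ (i x) (W (i x))).re - m * ‖i x‖ ^ 2 := by
    intro x
    rw [hB, inner_self_eq_norm_sq_to_K, inner_self_eq_norm_sq_to_K]
    simp [← Complex.ofReal_pow]
  set N : ℝ := ‖W‖ + |m| with hN
  have hN0 : 0 ≤ N := by positivity
  have hpos : 0 < l - m := sub_pos.2 hm
  -- This `c` solves `(1 - c)(l - m) - cN = c`. The combination with weights `1 - c` and `c` of the
  -- two lower bounds `e1`, `e2` below is then exactly `c` times the squared graph norm.
  set c : ℝ := (l - m) / (l - m + N + 1) with hc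
  have hc0 : 0 < c := by positivity
  have hc1 : c ≤ 1 := by rw [hc, div_le_one (by positivity)]; linarith
  have hc2 : c * (l - m + N + 1) = l - m := by rw [hc]; field_simp
  have hcoer : ∀ x, c * ‖x‖ ^ 2 ≤ (inner ℂ x (B x)).re := by
    intro x
    have h1 := hl _ (hmem x)
    have h2 : (inner ℂ (i x) (W (i x))).re ≤ ‖W‖ * ‖i x‖ ^ 2 := by
      calc (inner ℂ (i x) (W (i x))).re ≤ ‖i x‖ * ‖W (i x)‖ := re_inner_le_norm (𝕜 := ℂ) _ _
        _ ≤ ‖i x‖ * (‖W‖ * ‖i x‖) := by gcongr; exact W.le_opNorm _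
        _ = _ := by ring
    have h3 : m * ‖i x‖ ^ 2 ≤ |m| * ‖i x‖ ^ 2 := by gcongr; exact le_abs_self m
    rw [hself, hnorm]
    set q := ‖δ x‖ ^ 2 - (inner ℂ (i x) (W (i x))).re - m * ‖i x‖ ^ 2 with hq
    have e1 : (l - m) * ‖i x‖ ^ 2 ≤ q := by rw [hq]; simp only at h1; linarith
    have e2 : ‖δ x‖ ^ 2 - N * ‖i x‖ ^ 2 ≤ q := by rw [hq, hN]; linarith
    have e3 := mul_le_mul_of_nonneg_left e1 (sub_nonneg.2 hc1)
    have e4 := mul_le_mul_of_nonneg_left e2 hc0.le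
    have e5 : (l - m) - c * (l - m) - c * N = c := by linarith
    have : c * ‖i x‖ ^ 2 = (1 - c) * ((l - m) * ‖i x‖ ^ 2) - c * (N * ‖i x‖ ^ 2) := by
      linear_combination -(‖i x‖ ^ 2) * e5
    linarith
  have hunit : IsUnit B := by
    refine B.isUnit_of_forall_le_norm_inner_map (c := ⟨c, hc0.le⟩) hc0 fun x => ?_
    rw [norm_inner_symm]
    calc ‖x‖ ^ 2 * c = c * ‖x‖ ^ 2 := mul_comm _ _
      _ ≤ _ := hcoer x
      _ ≤ _ := Complex.re_le_norm _
  obtain ⟨U, hU⟩ := hunit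
  have hBU : ∀ x, B ((↑U⁻¹ : hilbertGraph G →L[ℂ] hilbertGraph G) x) = x := fun x => by
    rw [← hU, ← mul_apply_eq_comp, U.mul_inv]; rfl
  have hUB : ∀ x, (↑U⁻¹ : hilbertGraph G →L[ℂ] hilbertGraph G) (B x) = x := fun x => by
    rw [← hU, ← mul_apply_eq_comp, U.inv_mul]; rfl
  refine ⟨i ∘L (↑U⁻¹ : hilbertGraph G →L[ℂ] hilbertGraph G) ∘L ContinuousLinearMap.adjoint i,
    fun f => ?_, fun x => ?_⟩
  · set y := (↑U⁻¹ : hilbertGraph G →L[ℂ] hilbertGraph G) (ContinuousLinearMap.adjoint i f) with hy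
    have hgr : (i y, f + (m : ℂ) • i y) ∈ T.graph := by
      rw [hT]
      refine ⟨δ y, hmem y, fun q hq => ?_⟩
      let z : hilbertGraph G := ⟨WithLp.toLp 2 q, hq⟩
      have h := hB y z
      rw [hy, hBU, ← hy, ContinuousLinearMap.adjoint_inner_right] at h
      change inner ℂ q.1 f = inner ℂ q.2 (δ y) - inner ℂ q.1 (W (i y)) - m * inner ℂ q.1 (i y) at h
      rw [inner_add_right, inner_smul_right, h]
      ring
    obtain ⟨z, hz1, hz2⟩ := (LinearPMap.mem_graph_iff _).1 hgr
    refine ⟨by have := z.2; rw [hz1] at this; exact this, ?_⟩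
    have : (⟨i y, by have := z.2; rw [hz1] at this; exact this⟩ : T.domain) = z :=
      Subtype.ext hz1.symm
    change T ⟨i y, _⟩ - (m : ℂ) • i y = f
    rw [this, hz2]
    simp
  · obtain ⟨x', hx', hx⟩ := (hT _ _).1 (T.mem_graph x)
    let y : hilbertGraph G := ⟨WithLp.toLp 2 ((x : H), x'), hx'⟩
    have hy : B y = ContinuousLinearMap.adjoint i (T x - (m : ℂ) • (x : H)) := by
      refine ext_inner_left ℂ fun z => ?_
      rw [hB, ContinuousLinearMap.adjoint_inner_right, inner_sub_right, inner_smul_right,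
        ← hx _ (hmem z)]
      rfl
    change i ((↑U⁻¹ : hilbertGraph G →L[ℂ] hilbertGraph G) (ContinuousLinearMap.adjoint i _)) = _
    rw [← hy, hUB]
    rfl

/-- The bottom of the spectrum of the operator associated with a Schrödinger form is the optimal
lower bound of the form (variational principle). -/
theorem le_infSpec_iff {G : Submodule ℂ (H × H)} (hG : IsClosed (G : Set (H × H)))
    (W : H →L[ℂ] H) (hW : ∀ u v, inner ℂ (W u) v = inner ℂ u (W v)) (T : H →ₗ.[ℂ] H)
    (hT : ∀ u w, (u, w) ∈ T.graph ↔ ∃ u', (u, u') ∈ G ∧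
      ∀ q ∈ G, inner ℂ q.2 u' - inner ℂ q.1 (W u) = inner ℂ q.1 w) (l : ℝ) :
    (l : EReal) ≤ infSpec T ↔
      ∀ p ∈ G, l * ‖p.1‖ ^ 2 ≤ ‖p.2‖ ^ 2 - (inner ℂ p.1 (W p.1)).re := by
  constructor
  · intro hl p hp
    by_cases hp0 : p.1 = 0
    · simp [hp0]
    set S : Set ℝ := {r | ∃ q ∈ G, q.1 ≠ 0 ∧
      r = (‖q.2‖ ^ 2 - (inner ℂ q.1 (W q.1)).re) / ‖q.1‖ ^ 2} with hS
    have hbdd : BddBelow S := by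
      refine ⟨-‖W‖, ?_⟩
      rintro r ⟨q, hq, hq0, rfl⟩
      have hq0' : 0 < ‖q.1‖ := norm_pos_iff.2 hq0
      rw [le_div_iff₀ (by positivity)]
      have h2 : (inner ℂ q.1 (W q.1)).re ≤ ‖W‖ * ‖q.1‖ ^ 2 := by
        calc (inner ℂ q.1 (W q.1)).re ≤ ‖q.1‖ * ‖W q.1‖ := re_inner_le_norm (𝕜 := ℂ) _ _
          _ ≤ ‖q.1‖ * (‖W‖ * ‖q.1‖) := by gcongr; exact W.le_opNorm _
          _ = _ := by ring
      nlinarith [sq_nonneg ‖q.2‖]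
    have hle : ∀ q ∈ G, sInf S * ‖q.1‖ ^ 2 ≤ ‖q.2‖ ^ 2 - (inner ℂ q.1 (W q.1)).re := by
      intro q hq
      by_cases hq0 : q.1 = 0
      · simp [hq0]
      have hq0' : 0 < ‖q.1‖ := norm_pos_iff.2 hq0
      rw [← le_div_iff₀ (by positivity)]
      exact csInf_le hbdd ⟨q, hq, hq0, rfl⟩
    -- The infimum `E` of the Rayleigh quotients is in the spectrum: a bounded resolvent `R` at `E`
    -- would raise the lower bound to `E + 1/c`. This avoids the spectral theorem.
    have hspec : ((sInf S : ℝ) : ℂ) ∈ pmapSpectrum T := by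
      rintro ⟨R, hR, -⟩
      set E := sInf S
      set c := ‖R‖ + 1 with hc
      have hc0 : 0 < c := by positivity
      have key : ∀ q ∈ G, q.1 ≠ 0 →
          E + 1 / c ≤ (‖q.2‖ ^ 2 - (inner ℂ q.1 (W q.1)).re) / ‖q.1‖ ^ 2 := by
        intro q hq hq0
        have hq0' : 0 < ‖q.1‖ := norm_pos_iff.2 hq0
        rw [le_div_iff₀ (by positivity)]
        obtain ⟨hf, hfe⟩ := hR q.1
        have hfe' : T ⟨R q.1, hf⟩ = q.1 + (E : ℂ) • R q.1 := eq_add_of_sub_eq hfe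
        obtain ⟨v', hv, hvq⟩ := (hT _ _).1 (hfe' ▸ T.mem_graph ⟨R q.1, hf⟩)
        set v := R q.1 with hvdef
        change (v, v') ∈ G at hv
        change ∀ q_1 ∈ G, inner ℂ q_1.2 v' - inner ℂ q_1.1 (W v) =
          inner ℂ q_1.1 (q.1 + (E : ℂ) • v) at hvq
        have h1 := hvq q hq
        have h2 := hvq (v, v') hv
        simp only [inner_add_right, inner_smul_right] at h1 h2
        -- Write `a ≥ 0` for the form shifted by `E`, and `τ = 1/c`. Since `v = R q.1`,
        -- nonnegativity of `a` at `q - τ v` reads `a(q) ≥ 2τ‖q.1‖² - τ² Re⟨v, q.1⟩`. With `Re⟨v,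
        -- q.1⟩ ≤ c‖q.1‖²` the right side is at least `τ‖q.1‖²`.
        have hmem : q - ((1 / c : ℝ) : ℂ) • (v, v') ∈ G := G.sub_mem hq (G.smul_mem _ hv)
        have h3 := hle _ hmem
        have h4 : (inner ℂ v q.1).re ≤ c * ‖q.1‖ ^ 2 := by
          calc (inner ℂ v q.1).re ≤ ‖v‖ * ‖q.1‖ := re_inner_le_norm (𝕜 := ℂ) _ _
            _ ≤ (‖R‖ * ‖q.1‖) * ‖q.1‖ := by gcongr; exact R.le_opNorm _
            _ ≤ (c * ‖q.1‖) * ‖q.1‖ := by gcongr; linarith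
            _ = _ := by ring
        have e1 := congrArg Complex.re h1
        have e2 := congrArg Complex.re h2
        have sq : ∀ x : H, ‖x‖ ^ 2 = (inner ℂ x x).re := fun x => norm_sq_eq_re_inner (𝕜 := ℂ) x
        have symW : (inner ℂ v (W q.1)).re = (inner ℂ q.1 (W v)).re := by
          rw [← hW, ← inner_conj_symm, Complex.conj_re]
        have sym1 : (inner ℂ v q.1).re = (inner ℂ q.1 v).re := by
          rw [← inner_conj_symm, Complex.conj_re]
        have sym2 : (inner ℂ v' q.2).re = (inner ℂ q.2 v').re := by
          rw [← inner_conj_symm, Complex.conj_re]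
        simp only [Prod.fst_sub, Prod.snd_sub, Prod.smul_fst, Prod.smul_snd, sq, map_sub, map_smul,
          inner_sub_left, inner_sub_right, inner_smul_left, inner_smul_right, Complex.conj_ofReal,
          Complex.sub_re, Complex.re_ofReal_mul, Complex.add_re] at h3 e1 e2 h4 ⊢
        rw [symW, sym1, sym2] at h3
        rw [sym1] at h4 e2
        have hτ : (1 / c) * c = 1 := by field_simp
        set τ := 1 / c
        have hτ0 : 0 < τ := by positivity
        have h5 := mul_le_mul_of_nonneg_left h4 (sq_nonneg τ)
        have h6 : τ ^ 2 * (c * (inner ℂ q.1 q.1).re) = τ * (inner ℂ q.1 q.1).re := by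
          linear_combination (τ * (inner ℂ q.1 q.1).re) * hτ
        have e1' := congrArg (fun x => 2 * τ * x) e1
        have e2' := congrArg (fun x => τ ^ 2 * x) e2
        nlinarith
      have : E + 1 / c ≤ E := by
        refine le_csInf ⟨_, p, hp, hp0, rfl⟩ ?_
        rintro r ⟨q, hq, hq0, rfl⟩
        exact key q hq hq0
      have : 0 < 1 / c := by positivity
      linarith
    have h1 : (l : EReal) ≤ (sInf S : ℝ) :=
      hl.trans (iInf_le (fun x : {x : ℝ // (x : ℂ) ∈ pmapSpectrum T} => ((x : ℝ) : EReal))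
        ⟨sInf S, hspec⟩)
    have h2 : l ≤ sInf S := EReal.coe_le_coe_iff.1 h1
    exact le_trans (by gcongr) (hle p hp)
  · intro hl
    refine le_iInf fun x => ?_
    rw [EReal.coe_le_coe_iff]
    by_contra hx
    exact x.2 (mem_pmapResolventSet_of_lt hG W T hT hl (not_le.1 hx))

end Abstract

/-! ## Absolutely continuous functions on intervals -/

namespace HasACDeriv

variable {f f' g g' : ℝ → ℂ} {a b c d : ℝ}

theorem sub_eq (h : HasACDeriv f f' a b) {s t : ℝ} (hs : s ∈ Icc a b) (ht : t ∈ Icc a b) :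
    f t - f s = ∫ r in s..t, f' r := by
  have hab : a ≤ b := hs.1.trans hs.2
  have h1 : IntervalIntegrable f' volume a s :=
    h.1.mono_set (by rw [uIcc_of_le hs.1, uIcc_of_le hab]; exact Icc_subset_Icc_right hs.2)
  have h2 : IntervalIntegrable f' volume a t :=
    h.1.mono_set (by rw [uIcc_of_le ht.1, uIcc_of_le hab]; exact Icc_subset_Icc_right ht.2)
  rw [h.2 t ht, h.2 s hs, ← intervalIntegral.integral_interval_sub_left h2 h1]
  ring

theorem intervalIntegrable (h : HasACDeriv f f' a b) {s t : ℝ} (hs : s ∈ Icc a b)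
    (ht : t ∈ Icc a b) : IntervalIntegrable f' volume s t := by
  refine h.1.mono_set ?_
  rw [uIcc_of_le (hs.1.trans hs.2)]
  exact uIcc_subset_Icc hs ht

theorem mono (h : HasACDeriv f f' a b) (hc : c ∈ Icc a b) (hd : d ∈ Icc a b) :
    HasACDeriv f f' c d := by
  refine ⟨h.intervalIntegrable hc hd, fun t ht => ?_⟩
  have := h.sub_eq hc ⟨hc.1.trans ht.1, ht.2.trans hd.2⟩
  rw [← this]; ring

theorem trans (h : HasACDeriv f f' a b) (h' : HasACDeriv f f' b c) (hab : a ≤ b) (hbc : b ≤ c) :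
    HasACDeriv f f' a c := by
  refine ⟨h.1.trans h'.1, fun t ht => ?_⟩
  rcases le_total t b with htb | htb
  · exact h.2 t ⟨ht.1, htb⟩
  · rw [h'.2 t ⟨htb, ht.2⟩, h.2 b ⟨hab, le_rfl⟩, add_assoc,
      intervalIntegral.integral_add_adjacent_intervals h.1
        (h'.intervalIntegrable ⟨le_rfl, hbc⟩ ⟨htb, ht.2⟩)]

theorem congr (h : HasACDeriv f f' a b) (hab : a ≤ b) (hfg : ∀ t ∈ Icc a b, f t = g t)
    (hfg' : f' =ᵐ[volume.restrict (Ioc a b)] g') : HasACDeriv g g' a b := by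
  refine ⟨h.1.congr_ae (by rwa [uIoc_of_le hab]), fun t ht => ?_⟩
  rw [← hfg t ht, ← hfg a ⟨le_rfl, hab⟩, h.2 t ht]
  congr 1
  refine intervalIntegral.integral_congr_ae ?_
  rw [uIoc_of_le ht.1]
  filter_upwards [(ae_restrict_iff' measurableSet_Ioc).1 hfg'] with s hs hst
  exact hs ⟨hst.1, hst.2.trans ht.2⟩

theorem continuousOn (h : HasACDeriv f f' a b) (hab : a ≤ b) : ContinuousOn f (Icc a b) := by
  have h1 : IntegrableOn f' (uIcc a b) volume := by
    rw [uIcc_of_le hab]; exact (intervalIntegrable_iff_integrableOn_Icc_of_le hab).1 h.1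
  have := intervalIntegral.continuousOn_primitive_interval h1
  rw [uIcc_of_le hab] at this
  exact (continuousOn_const.add this).congr fun t ht => h.2 t ht

/-- Continuity upgrades vanishing almost everywhere to vanishing everywhere, and Lebesgue
differentiation recovers `f'` from its primitive. -/
theorem ae_eq_zero (h : HasACDeriv f f' a b) (hab : a < b)
    (hf : ∀ᵐ t ∂volume.restrict (Ioc a b), f t = 0) :
    ∀ᵐ t ∂volume.restrict (Ioc a b), f' t = 0 := by
  have h0 : EqOn f (fun _ => 0) (Icc a b) := by
    refine Measure.eqOn_Icc_of_ae_eq volume hab.ne ?_ (h.continuousOn hab.le) continuousOn_const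
    rw [← restrict_Ioc_eq_restrict_Icc]
    exact hf
  have h1 : ∀ᵐ x : ℝ, x ≠ b := by simp [ae_iff, measure_singleton]
  rw [ae_restrict_iff' measurableSet_Ioc]
  filter_upwards [h.1.ae_hasDerivAt_integral, h1] with x hx hxb hxm
  rw [uIcc_of_le hab.le] at hx
  have hd := hx (Ioc_subset_Icc_self hxm) a ⟨le_rfl, hab.le⟩
  refine hd.unique ?_
  refine (hasDerivAt_const x (0 : ℂ)).congr_of_eventuallyEq ?_
  filter_upwards [Ioo_mem_nhds hxm.1 (lt_of_le_of_ne hxm.2 hxb)] with y hy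
  have hym := Ioo_subset_Icc_self hy
  rw [← h.sub_eq ⟨le_rfl, hab.le⟩ hym, h0 hym, h0 ⟨le_rfl, hab.le⟩]
  simp

end HasACDeriv

/-! ## Derivatives along a family of curves -/

section Curves

variable {X : Type*} [MeasurableSpace X] {μ : Measure X} {ι : Type*} {γ : ι → ℝ → X} {a b : ι → ℝ}
  {G : Submodule ℂ (Lp ℂ 2 μ × Lp ℂ 2 μ)}

/-- `G` is the graph of the derivative along the curves `γ i`, parametrized by `[a i, b i]`. -/
structure IsCurveDerivGraph (γ : ι → ℝ → X) (a b : ι → ℝ)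
    (G : Submodule ℂ (Lp ℂ 2 μ × Lp ℂ 2 μ)) : Prop where
  lt : ∀ i, a i < b i
  measurable : ∀ i, Measurable (γ i)
  map_le : ∀ i, (volume.restrict (Ioc (a i) (b i))).map (γ i) ≤ μ
  mem_iff : ∀ p, p ∈ G ↔ ∃ f f' : X → ℂ, p.1 =ᵐ[μ] f ∧ p.2 =ᵐ[μ] f' ∧
    ∀ i, HasACDeriv (fun t => f (γ i t)) (fun t => f' (γ i t)) (a i) (b i)

namespace IsCurveDerivGraph

theorem ae_comp (h : IsCurveDerivGraph γ a b G) {P : X → Prop} (hP : ∀ᵐ x ∂μ, P x) (i : ι) :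
    ∀ᵐ t ∂volume.restrict (Ioc (a i) (b i)), P (γ i t) :=
  ae_of_ae_map (h.measurable i).aemeasurable (ae_mono (h.map_le i) hP)

theorem mem_iff' (h : IsCurveDerivGraph γ a b G) (p : Lp ℂ 2 μ × Lp ℂ 2 μ) :
    p ∈ G ↔ ∃ f : X → ℂ, p.1 =ᵐ[μ] f ∧
      ∀ i, HasACDeriv (fun t => f (γ i t)) (fun t => p.2 (γ i t)) (a i) (b i) := by
  rw [h.mem_iff]
  constructor
  · rintro ⟨f, f', h1, h2, h3⟩
    exact ⟨f, h1, fun i => (h3 i).congr (h.lt i).le (fun _ _ => rfl)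
      (h.ae_comp (h2.mono fun x hx => hx.symm) i)⟩
  · rintro ⟨f, h1, h2⟩
    exact ⟨f, p.2, h1, Filter.EventuallyEq.rfl, h2⟩

theorem memLp_comp (h : IsCurveDerivGraph γ a b G) {f : X → ℂ} (hf : MemLp f 2 μ) (i : ι) :
    MemLp (fun t => f (γ i t)) 2 (volume.restrict (Ioc (a i) (b i))) :=
  (hf.mono_measure (h.map_le i)).comp_of_map (h.measurable i).aemeasurable

/-- Hölder on an interval of finite length: convergence in `L²(μ)` becomes `L¹` convergence along
each curve, so integrals of derivatives pass to the limit. -/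
theorem eLpNorm_comp_le (h : IsCurveDerivGraph γ a b G) {f : X → ℂ} (hf : MemLp f 2 μ) (i : ι) :
    eLpNorm (fun t => f (γ i t)) 1 (volume.restrict (Ioc (a i) (b i))) ≤
      eLpNorm f 2 μ * volume (Ioc (a i) (b i)) ^ (1 / (1 : ℝ≥0∞).toReal - 1 / (2 : ℝ≥0∞).toReal) := by
  refine (eLpNorm_le_eLpNorm_mul_rpow_measure_univ (p := 1) (q := 2) (by norm_num)
    (h.memLp_comp hf i).1).trans ?_
  rw [Measure.restrict_apply_univ]
  gcongr
  change eLpNorm (f ∘ γ i) 2 _ ≤ _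
  rw [← eLpNorm_map_measure (hf.mono_measure (h.map_le i)).1 (h.measurable i).aemeasurable]
  exact eLpNorm_mono_measure f (h.map_le i)

/-- A subsequence of the functions converges almost everywhere, and the integrals of their
derivatives converge along each curve. One point of convergence on a curve thus forces convergence
at all its points, and the fundamental theorem of calculus survives in the limit. -/
theorem isClosed (h : IsCurveDerivGraph γ a b G) :
    IsClosed (G : Set (Lp ℂ 2 μ × Lp ℂ 2 μ)) := by
  refine IsSeqClosed.isClosed fun p q hp hpq => ?_
  have hp' := fun k => (h.mem_iff' (p k)).1 (hp k)
  choose f hf hac using hp'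
  have hlim1 : Tendsto (fun k => (p k).1) atTop (𝓝 q.1) := (continuous_fst.tendsto q).comp hpq
  have hlim2 : Tendsto (fun k => (p k).2) atTop (𝓝 q.2) := (continuous_snd.tendsto q).comp hpq
  obtain ⟨ns, hns, hae⟩ := (tendstoInMeasure_of_tendsto_Lp hlim1).exists_seq_tendsto_ae
  have hae' : ∀ᵐ x ∂μ, Tendsto (fun k => f (ns k) x) atTop (𝓝 (q.1 x)) := by
    filter_upwards [hae, ae_all_iff.2 fun k => hf (ns k)] with x hx hx'
    exact hx.congr hx'
  -- The limit is taken at points of `X`, not curve by curve, so one representative serves curves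
  -- that share a point. Where there is no limit, `limUnder` is arbitrary; `hconv` excludes this on
  -- the curves.
  refine (h.mem_iff' q).2 ⟨fun x => limUnder atTop fun k => f (ns k) x, ?_, fun i => ?_⟩
  · filter_upwards [hae'] with x hx
    exact hx.limUnder_eq.symm
  have hint : ∀ s ∈ Icc (a i) (b i), ∀ t ∈ Icc (a i) (b i), Tendsto
      (fun k => ∫ r in s..t, (p (ns k)).2 (γ i r)) atTop (𝓝 (∫ r in s..t, q.2 (γ i r))) := by
    have hL1 : Tendsto (fun k => eLpNorm ((fun r => (p (ns k)).2 (γ i r)) - fun r => q.2 (γ i r)) 1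
        (volume.restrict (Ioc (a i) (b i)))) atTop (𝓝 0) := by
      have h2 := ((Lp.tendsto_Lp_iff_tendsto_eLpNorm' _ _).1 hlim2).comp hns.tendsto_atTop
      have h3 := ENNReal.Tendsto.mul_const (b := volume (Ioc (a i) (b i)) ^
        (1 / (1 : ℝ≥0∞).toReal - 1 / (2 : ℝ≥0∞).toReal)) h2 (Or.inr (by
          simp only [Real.volume_Ioc]
          exact ENNReal.rpow_ne_top_of_nonneg (by norm_num) ENNReal.ofReal_ne_top))
      rw [zero_mul] at h3
      refine tendsto_of_tendsto_of_tendsto_of_le_of_le tendsto_const_nhds h3 (fun _ => zero_le)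
        fun k => ?_
      exact h.eLpNorm_comp_le ((Lp.memLp (p (ns k)).2).sub (Lp.memLp q.2)) i
    have key : ∀ s ∈ Icc (a i) (b i), ∀ t ∈ Icc (a i) (b i), Tendsto
        (fun k => ∫ r in Ioc s t, (p (ns k)).2 (γ i r)) atTop
        (𝓝 (∫ r in Ioc s t, q.2 (γ i r))) := by
      intro s hs t ht
      have := tendsto_setIntegral_of_L1' (fun r => q.2 (γ i r)) (h.memLp_comp (Lp.memLp q.2) i).1
        (Eventually.of_forall fun k =>
          (h.memLp_comp (Lp.memLp (p (ns k)).2) i).integrable (by norm_num)) hL1 (Ioc s t)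
      simpa only [Measure.restrict_restrict measurableSet_Ioc,
        inter_eq_left.2 (Ioc_subset_Ioc hs.1 ht.2)] using this
    intro s hs t ht
    simp only [_root_.intervalIntegral]
    exact (key s hs t ht).sub (key t ht s hs)
  have hle := (h.lt i).le
  obtain ⟨t₀, ht₀, htm⟩ : ∃ t₀, Tendsto (fun k => f (ns k) (γ i t₀)) atTop (𝓝 (q.1 (γ i t₀))) ∧
      t₀ ∈ Ioc (a i) (b i) := by
    have hne : NeBot (ae (volume.restrict (Ioc (a i) (b i)))) := by
      rw [ae_neBot, Ne, Measure.restrict_eq_zero, Real.volume_Ioc]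
      simp [h.lt i]
    exact ((h.ae_comp hae' i).and (ae_restrict_mem measurableSet_Ioc)).exists
  have hconv : ∀ t ∈ Icc (a i) (b i), Tendsto (fun k => f (ns k) (γ i t)) atTop
      (𝓝 (limUnder atTop fun k => f (ns k) (γ i t))) := by
    intro t ht
    have : Tendsto (fun k => f (ns k) (γ i t)) atTop
        (𝓝 (q.1 (γ i t₀) + ∫ r in t₀..t, q.2 (γ i r))) := by
      refine (ht₀.add (hint t₀ (Ioc_subset_Icc_self htm) t ht)).congr fun k => ?_
      rw [← (hac (ns k) i).sub_eq (Ioc_subset_Icc_self htm) ht]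
      ring
    rwa [this.limUnder_eq]
  have hi : IntervalIntegrable (fun t => q.2 (γ i t)) volume (a i) (b i) :=
    (intervalIntegrable_iff_integrableOn_Ioc_of_le hle).2
      ((h.memLp_comp (Lp.memLp q.2) i).integrable (by norm_num))
  refine ⟨hi, fun t ht => ?_⟩
  have ha : a i ∈ Icc (a i) (b i) := ⟨le_rfl, hle⟩
  refine tendsto_nhds_unique (hconv t ht) (((hconv _ ha).add (hint _ ha t ht)).congr fun k => ?_)
  exact ((hac (ns k) i).2 t ht).symm

/-- Single-valuedness of the derivative, without which `toLinearPMap` would not have graph `G`. The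
hypothesis `hcov` says that the curves cover `X` up to a null set. -/
theorem snd_eq_zero (h : IsCurveDerivGraph γ a b G)
    (hcov : ∀ f : X → ℂ, AEStronglyMeasurable f μ →
      (∀ i, ∀ᵐ t ∂volume.restrict (Ioc (a i) (b i)), f (γ i t) = 0) → f =ᵐ[μ] 0) :
    ∀ p ∈ G, p.1 = 0 → p.2 = 0 := by
  intro p hp hp1
  obtain ⟨f, hf, hac⟩ := (h.mem_iff' p).1 hp
  have hf0 : ∀ᵐ x ∂μ, f x = 0 := by
    rw [hp1] at hf
    filter_upwards [hf, Lp.coeFn_zero ℂ 2 μ] with x hx hx'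
    rw [← hx, hx']; rfl
  rw [Lp.eq_zero_iff_ae_eq_zero]
  exact hcov _ (Lp.memLp _).1 fun i => (hac i).ae_eq_zero (h.lt i) (h.ae_comp hf0 i)

end IsCurveDerivGraph

end Curves

/-! ## The variational principle for Schrödinger forms on `L²` spaces -/

section L2

variable {X : Type*} [MeasurableSpace X] {μ : Measure X}

theorem coeFn_mulOp (W : X → ℝ) (hW : MemLp W ∞ μ) (φ : Lp ℂ 2 μ) :
    mulOp W hW φ =ᵐ[μ] fun x => (W x : ℂ) * φ x :=
  MemLp.coeFn_toLp ((Lp.memLp φ).mul (p := ∞) (r := 2) hW.ofReal)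

/-- Multiplication by a bounded real function, as a bounded operator on `L²`. -/
noncomputable def mulCLM (W : X → ℝ) (hW : MemLp W ∞ μ) : Lp ℂ 2 μ →L[ℂ] Lp ℂ 2 μ :=
  (mulOp W hW).mkContinuous (eLpNorm W ∞ μ).toReal fun φ => by
    refine Lp.norm_le_mul_norm_of_ae_le_mul ?_
    filter_upwards [coeFn_mulOp W hW φ, ae_le_eLpNormEssSup (f := W) (μ := μ)] with x hx hx'
    rw [hx, norm_mul, Complex.norm_real]
    gcongr
    rw [← toReal_enorm]
    exact ENNReal.toReal_mono hW.2.ne hx'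

theorem inner_mulCLM_comm (W : X → ℝ) (hW : MemLp W ∞ μ) (φ ψ : Lp ℂ 2 μ) :
    inner ℂ (mulCLM W hW φ) ψ = inner ℂ φ (mulCLM W hW ψ) := by
  rw [L2.inner_def, L2.inner_def]
  refine integral_congr_ae ?_
  filter_upwards [coeFn_mulOp W hW φ, coeFn_mulOp W hW ψ] with x hx hx'
  change inner ℂ ((mulOp W hW φ : Lp ℂ 2 μ) x) _ = inner ℂ _ ((mulOp W hW ψ : Lp ℂ 2 μ) x)
  rw [hx, hx']
  simp only [RCLike.inner_apply, map_mul, Complex.conj_ofReal]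
  ring

theorem norm_sq_sub_inner_mulCLM (W : X → ℝ) (hW : MemLp W ∞ μ) (u u' : Lp ℂ 2 μ) :
    ‖u'‖ ^ 2 - (inner ℂ u (mulCLM W hW u)).re =
      (∫ x, ‖u' x‖ ^ 2 ∂μ) - ∫ x, W x * ‖u x‖ ^ 2 ∂μ := by
  have h1 : ‖u'‖ ^ 2 = ∫ x, ‖u' x‖ ^ 2 ∂μ := by
    rw [norm_sq_eq_re_inner (𝕜 := ℂ) u', L2.inner_def, ← integral_re (L2.integrable_inner _ _)]
    exact integral_congr_ae (ae_of_all _ fun x => (norm_sq_eq_re_inner (𝕜 := ℂ) (u' x)).symm)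
  have h2 : (inner ℂ u (mulCLM W hW u)).re = ∫ x, W x * ‖u x‖ ^ 2 ∂μ := by
    change RCLike.re (inner ℂ u (mulCLM W hW u)) = _
    rw [L2.inner_def, ← integral_re (L2.integrable_inner _ _)]
    refine integral_congr_ae ?_
    filter_upwards [coeFn_mulOp W hW u] with x hx
    change RCLike.re (inner ℂ _ ((mulOp W hW u : Lp ℂ 2 μ) x)) = _
    rw [hx]
    simp only [RCLike.inner_apply, mul_assoc, RCLike.mul_conj]
    change ((W x : ℂ) * ((‖u x‖ : ℂ) ^ 2)).re = _
    rw [← Complex.ofReal_pow, ← Complex.ofReal_mul, Complex.ofReal_re]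
  rw [h1, h2]

theorem norm_sq_eq_integral (u : Lp ℂ 2 μ) : ‖u‖ ^ 2 = ∫ x, ‖u x‖ ^ 2 ∂μ := by
  rw [norm_sq_eq_re_inner (𝕜 := ℂ) u, L2.inner_def, ← integral_re (L2.integrable_inner _ _)]
  exact integral_congr_ae (ae_of_all _ fun x => (norm_sq_eq_re_inner (𝕜 := ℂ) (u x)).symm)

/-- Density of the form domain makes `operatorGraph` single-valued, so that passing to a
`LinearPMap` loses nothing. -/
theorem SesqForm.graph_operator {H : Type*} [NormedAddCommGroup H] [InnerProductSpace ℂ H]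
    (h : SesqForm H) (hd : ∀ w, (∀ v ∈ h.domain, inner ℂ v w = 0) → w = 0) :
    h.operator.graph = h.operatorGraph := by
  refine Submodule.toLinearPMap_graph_eq _ ?_
  rintro ⟨u, w⟩ ⟨hu, hw⟩ hu0
  refine hd _ fun v hv => ?_
  rw [← hw ⟨v, hv⟩]
  have : (⟨u, hu⟩ : h.domain) = 0 := Subtype.ext hu0
  rw [this, map_zero]

/-- The form identity defining the operator associated with a form of the type
`(u, v) ↦ ⟨D u, D v⟩ - ⟨u, W v⟩`, in terms of the graph of `D`. -/
theorem forall_domain_toLinearPMap_iff {H : Type*} [NormedAddCommGroup H] [InnerProductSpace ℂ H]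
    {G : Submodule ℂ (H × H)} (hG : ∀ p ∈ G, p.1 = 0 → p.2 = 0) (W : H → H) (u w : H) :
    (∃ hu : u ∈ G.toLinearPMap.domain, ∀ v : G.toLinearPMap.domain,
      inner ℂ (G.toLinearPMap v) (G.toLinearPMap ⟨u, hu⟩) - inner ℂ (v : H) (W u) =
        inner ℂ (v : H) w) ↔
    ∃ u', (u, u') ∈ G ∧ ∀ q ∈ G, inner ℂ q.2 u' - inner ℂ q.1 (W u) = inner ℂ q.1 w := by
  have hgr := Submodule.toLinearPMap_graph_eq G hG
  constructor
  · rintro ⟨hu, h⟩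
    refine ⟨_, Submodule.mem_graph_toLinearPMap hG ⟨u, hu⟩, fun q hq => ?_⟩
    rw [← hgr, LinearPMap.mem_graph_iff] at hq
    obtain ⟨y, hy1, hy2⟩ := hq
    rw [← hy1, ← hy2]
    exact h y
  · rintro ⟨u', hu', h⟩
    rw [← hgr, LinearPMap.mem_graph_iff] at hu'
    obtain ⟨y, hy1, hy2⟩ := hu'
    simp only at hy1 hy2
    subst hy1
    refine ⟨y.2, fun v => ?_⟩
    rw [hy2]
    exact h _ (Submodule.mem_graph_toLinearPMap hG v)

variable {G : Submodule ℂ (Lp ℂ 2 μ × Lp ℂ 2 μ)}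

theorem le_infSpec_schrodingerForm_iff (hG : IsClosed (G : Set (Lp ℂ 2 μ × Lp ℂ 2 μ)))
    (hG0 : ∀ p ∈ G, p.1 = 0 → p.2 = 0)
    (hd : ∀ w : Lp ℂ 2 μ, (∀ p ∈ G, inner ℂ p.1 w = 0) → w = 0)
    (W : X → ℝ) (hW : MemLp W ∞ μ) (l : ℝ) :
    (l : EReal) ≤ infSpec (schrodingerForm G.toLinearPMap W hW).operator ↔
      ∀ p ∈ G, l * ∫ x, ‖p.1 x‖ ^ 2 ∂μ ≤
        (∫ x, ‖p.2 x‖ ^ 2 ∂μ) - ∫ x, W x * ‖p.1 x‖ ^ 2 ∂μ := by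
  rw [le_infSpec_iff hG (mulCLM W hW) (inner_mulCLM_comm W hW)]
  · simp only [norm_sq_sub_inner_mulCLM]
    simp only [norm_sq_eq_integral]
  · intro u w
    rw [SesqForm.graph_operator]
    · exact forall_domain_toLinearPMap_iff hG0 (mulOp W hW) u w
    · intro w hw
      exact hd w fun p hp => hw _ ⟨p, hp, rfl⟩

/-- The tree operator is a difference of operators, not the operator of a form. The potential is
bounded, so moving it to the other side of the weak equation shows that both constructions have the
same graph. -/
theorem le_infSpec_energyForm_sub_iff (hG : IsClosed (G : Set (Lp ℂ 2 μ × Lp ℂ 2 μ)))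
    (hG0 : ∀ p ∈ G, p.1 = 0 → p.2 = 0)
    (hd : ∀ w : Lp ℂ 2 μ, (∀ p ∈ G, inner ℂ p.1 w = 0) → w = 0)
    (W : X → ℝ) (hW : MemLp W ∞ μ) (l : ℝ) :
    (l : EReal) ≤ infSpec ((energyForm G.toLinearPMap).operator - (mulOp W hW).toPMap ⊤) ↔
      ∀ p ∈ G, l * ∫ x, ‖p.1 x‖ ^ 2 ∂μ ≤
        (∫ x, ‖p.2 x‖ ^ 2 ∂μ) - ∫ x, W x * ‖p.1 x‖ ^ 2 ∂μ := by
  have hgr : ((energyForm G.toLinearPMap).operator - (mulOp W hW).toPMap ⊤).graph =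
      (schrodingerForm G.toLinearPMap W hW).operatorGraph := by
    have hE := (energyForm G.toLinearPMap).graph_operator fun w hw =>
      hd w fun p hp => hw _ ⟨p, hp, rfl⟩
    have hsch : ∀ u w, (u, w) ∈ (schrodingerForm G.toLinearPMap W hW).operatorGraph ↔
        (u, w + mulOp W hW u) ∈ (energyForm G.toLinearPMap).operatorGraph := by
      intro u w
      refine exists_congr fun hu => forall_congr' fun v => ?_
      change inner ℂ (G.toLinearPMap v) (G.toLinearPMap ⟨u, hu⟩) -
          inner ℂ (v : Lp ℂ 2 μ) (mulOp W hW u) = inner ℂ (v : Lp ℂ 2 μ) w ↔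
        inner ℂ (G.toLinearPMap v) (G.toLinearPMap ⟨u, hu⟩) =
          inner ℂ (v : Lp ℂ 2 μ) (w + mulOp W hW u)
      rw [inner_add_right, sub_eq_iff_eq_add]
    ext ⟨u, w⟩
    rw [hsch, ← hE, LinearPMap.mem_graph_iff, LinearPMap.mem_graph_iff]
    constructor
    · rintro ⟨y, hy1, hy2⟩
      refine ⟨⟨y, y.2.1⟩, hy1, ?_⟩
      simp only at hy1 hy2 ⊢
      rw [← hy2, ← hy1, LinearPMap.sub_apply]
      simp
    · rintro ⟨y, hy1, hy2⟩
      refine ⟨⟨y, y.2, trivial⟩, hy1, ?_⟩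
      simp only at hy1 hy2 ⊢
      rw [LinearPMap.sub_apply]
      subst hy1
      exact sub_eq_of_eq_add hy2
  rw [le_infSpec_iff hG (mulCLM W hW) (inner_mulCLM_comm W hW)]
  · simp only [norm_sq_sub_inner_mulCLM]
    simp only [norm_sq_eq_integral]
  · intro u w
    rw [hgr]
    exact forall_domain_toLinearPMap_iff hG0 (mulOp W hW) u w

end L2

/-- Passage from `L²` classes to honest functions, where radial functions and spherical means can be
formed. -/
theorem IsCurveDerivGraph.forall_mem_iff {X : Type*} [MeasurableSpace X] {μ : Measure X}
    {ι : Type*} {γ : ι → ℝ → X} {a b : ι → ℝ} {G : Submodule ℂ (Lp ℂ 2 μ × Lp ℂ 2 μ)}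
    (h : IsCurveDerivGraph γ a b G) (W : X → ℝ) (l : ℝ) :
    (∀ p ∈ G, l * ∫ x, ‖p.1 x‖ ^ 2 ∂μ ≤ (∫ x, ‖p.2 x‖ ^ 2 ∂μ) - ∫ x, W x * ‖p.1 x‖ ^ 2 ∂μ) ↔
    ∀ f f' : X → ℂ, MemLp f 2 μ → MemLp f' 2 μ →
      (∀ i, HasACDeriv (fun t => f (γ i t)) (fun t => f' (γ i t)) (a i) (b i)) →
      l * ∫ x, ‖f x‖ ^ 2 ∂μ ≤ (∫ x, ‖f' x‖ ^ 2 ∂μ) - ∫ x, W x * ‖f x‖ ^ 2 ∂μ := by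
  have key : ∀ (p : Lp ℂ 2 μ × Lp ℂ 2 μ) (f f' : X → ℂ), p.1 =ᵐ[μ] f → p.2 =ᵐ[μ] f' →
      (∫ x, ‖p.1 x‖ ^ 2 ∂μ = ∫ x, ‖f x‖ ^ 2 ∂μ) ∧ (∫ x, ‖p.2 x‖ ^ 2 ∂μ = ∫ x, ‖f' x‖ ^ 2 ∂μ) ∧
        ∫ x, W x * ‖p.1 x‖ ^ 2 ∂μ = ∫ x, W x * ‖f x‖ ^ 2 ∂μ := fun p f f' h1 h2 =>
    ⟨integral_congr_ae (h1.mono fun x hx => by simp only [hx]),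
      integral_congr_ae (h2.mono fun x hx => by simp only [hx]),
      integral_congr_ae (h1.mono fun x hx => by simp only [hx])⟩
  constructor
  · intro H f f' hf hf' hac
    obtain ⟨e1, e2, e3⟩ := key (hf.toLp f, hf'.toLp f') f f' hf.coeFn_toLp hf'.coeFn_toLp
    rw [← e1, ← e2, ← e3]
    exact H _ ((h.mem_iff _).2 ⟨f, f', hf.coeFn_toLp, hf'.coeFn_toLp, hac⟩)
  · intro H p hp
    obtain ⟨f, f', h1, h2, hac⟩ := (h.mem_iff _).1 hp
    obtain ⟨e1, e2, e3⟩ := key p f f' h1 h2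
    rw [e1, e2, e3]
    exact H f f' ((memLp_congr_ae h1).1 (Lp.memLp _)) ((memLp_congr_ae h2).1 (Lp.memLp _)) hac

/-! ### Variational principle on the weighted half-line -/

theorem HasACDeriv.of_contDiff {g : ℝ → ℝ} (hg : ContDiff ℝ 1 g) (a b : ℝ) :
    HasACDeriv (fun t => (g t : ℂ)) (fun t => ((_root_.deriv g t : ℝ) : ℂ)) a b := by
  have hc : Continuous fun t => ((_root_.deriv g t : ℝ) : ℂ) :=
    Complex.continuous_ofReal.comp (hg.continuous_deriv le_rfl)
  refine ⟨hc.intervalIntegrable _ _, fun t _ => ?_⟩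
  rw [intervalIntegral.integral_eq_sub_of_hasDerivAt (f := fun t => (g t : ℂ))
    (fun x _ => ((hg.differentiable one_ne_zero x).hasDerivAt).ofReal_comp)
    (hc.intervalIntegrable _ _)]
  ring

theorem continuous_weight {d : ℝ} (hd : 1 < d) : Continuous fun t : ℝ => (1 + t) ^ (d - 1) :=
  (continuous_const.add continuous_id).rpow_const fun _ => Or.inr (by linarith)

theorem isLocallyFiniteMeasure_halfLineMeasure {d : ℝ} (hd : 1 < d) :
    IsLocallyFiniteMeasure (halfLineMeasure d) :=
  IsLocallyFiniteMeasure.withDensity_ofReal (continuous_weight hd)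

theorem restrict_Ioi_le_halfLineMeasure {d : ℝ} (hd : 1 < d) :
    volume.restrict (Ioi 0) ≤ halfLineMeasure d := by
  conv_lhs => rw [← withDensity_one (μ := volume.restrict (Ioi (0 : ℝ)))]
  refine withDensity_mono ?_
  filter_upwards [ae_restrict_mem measurableSet_Ioi] with t ht
  rw [Pi.one_apply, ← ENNReal.ofReal_one]
  exact ENNReal.ofReal_le_ofReal (Real.one_le_rpow (by linarith [mem_Ioi.1 ht]) (by linarith))

/-- The curves are the identity on all compact subintervals of `(0, ∞)`. The weight is at least one
there, so Lebesgue measure is dominated by the weighted measure. -/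
theorem isCurveDerivGraph_halfLine {d : ℝ} (hd : 1 < d) :
    IsCurveDerivGraph (fun _ : {p : ℝ × ℝ // 0 < p.1 ∧ p.1 < p.2} => (id : ℝ → ℝ))
      (fun p => p.1.1) (fun p => p.1.2) (halfLineDerivGraph d) where
  lt p := p.2.2
  measurable _ := measurable_id
  map_le p := by
    rw [Measure.map_id]
    refine le_trans (Measure.restrict_mono ?_ le_rfl) (restrict_Ioi_le_halfLineMeasure hd)
    exact fun t ht => p.2.1.trans ht.1
  mem_iff p := by
    refine exists_congr fun f => exists_congr fun f' => and_congr_right fun _ =>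
      and_congr_right fun _ => ?_
    exact ⟨fun h i => h i.1.1 i.1.2 i.2.1 i.2.2, fun h a b ha hab => h ⟨(a, b), ha, hab⟩⟩

theorem ae_halfLineMeasure_of_forall_Ioc {d : ℝ} {P : ℝ → Prop}
    (h : ∀ a b, 0 < a → a < b → ∀ᵐ t ∂volume.restrict (Ioc a b), P t) :
    ∀ᵐ t ∂halfLineMeasure d, P t := by
  refine (withDensity_absolutelyContinuous _ _).ae_le ?_
  -- The right end `n + 2`, instead of `n + 1`, keeps the interval nondegenerate at `n = 0`.
  have hU : Ioi (0 : ℝ) = ⋃ n : ℕ, Ioc (1 / ((n : ℝ) + 1)) (n + 2) := by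
    ext t
    simp only [mem_Ioi, mem_iUnion, mem_Ioc]
    constructor
    · intro ht
      obtain ⟨n, hn⟩ := exists_nat_one_div_lt ht
      obtain ⟨m, hm⟩ := exists_nat_ge t
      refine ⟨max n m, ?_, ?_⟩
      · refine lt_of_le_of_lt (one_div_le_one_div_of_le (by positivity) ?_) hn
        push_cast; gcongr; exact le_max_left _ _
      · push_cast; linarith [le_max_right (n : ℝ) m]
    · rintro ⟨n, hn, -⟩
      exact lt_trans (by positivity) hn
  rw [hU]
  refine (ae_restrict_iUnion_iff _ _).2 fun n => h _ _ (by positivity) ?_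
  rw [div_lt_iff₀ (by positivity)]
  nlinarith [(Nat.cast_nonneg n : (0 : ℝ) ≤ n)]

theorem eq_zero_of_forall_inner_halfLineDerivGraph {d : ℝ} (hd : 1 < d)
    (w : Lp ℂ 2 (halfLineMeasure d)) (hw : ∀ p ∈ halfLineDerivGraph d, inner ℂ p.1 w = 0) :
    w = 0 := by
  have := isLocallyFiniteMeasure_halfLineMeasure hd
  rw [Lp.eq_zero_iff_ae_eq_zero]
  refine ae_eq_zero_of_integral_contDiff_smul_eq_zero
    ((Lp.memLp w).locallyIntegrable (by norm_num)) fun g hg hgc => ?_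
  have hg1 : ContDiff ℝ 1 g := hg.of_le (by norm_num)
  have h1 : MemLp (fun t => (g t : ℂ)) 2 (halfLineMeasure d) :=
    (Complex.continuous_ofReal.comp hg.continuous).memLp_of_hasCompactSupport
      (hgc.comp_left Complex.ofReal_zero)
  have h2 : MemLp (fun t => ((_root_.deriv g t : ℝ) : ℂ)) 2 (halfLineMeasure d) :=
    (Complex.continuous_ofReal.comp (hg1.continuous_deriv le_rfl)).memLp_of_hasCompactSupport
      (hgc.deriv.comp_left Complex.ofReal_zero)
  have h3 := hw (h1.toLp _, h2.toLp _)
    ⟨_, _, h1.coeFn_toLp, h2.coeFn_toLp, fun a b _ _ => HasACDeriv.of_contDiff hg1 a b⟩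
  rw [L2.inner_def] at h3
  rw [← h3]
  refine integral_congr_ae ?_
  filter_upwards [h1.coeFn_toLp] with t ht
  rw [ht]
  simp [mul_comm]

/-- The variational principle for the half-line operators. -/
theorem le_infSpec_halfLineOperator_iff {d : ℝ} (hd : 1 < d) (V : ℝ → ℝ)
    (hV : IsBoundedPotential V) (c l : ℝ) :
    (l : EReal) ≤ infSpec (halfLineOperator d V hV c) ↔
      ∀ f f' : ℝ → ℂ, MemLp f 2 (halfLineMeasure d) → MemLp f' 2 (halfLineMeasure d) →
        (∀ a b, 0 < a → a < b → HasACDeriv f f' a b) →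
        l * ∫ t, ‖f t‖ ^ 2 ∂halfLineMeasure d ≤
          (∫ t, ‖f' t‖ ^ 2 ∂halfLineMeasure d) - ∫ t, c * V t * ‖f t‖ ^ 2 ∂halfLineMeasure d := by
  have hG := isCurveDerivGraph_halfLine hd
  have h := le_infSpec_schrodingerForm_iff hG.isClosed
    (hG.snd_eq_zero fun f _ hf =>
      ae_halfLineMeasure_of_forall_Ioc fun a b ha hab => hf ⟨(a, b), ha, hab⟩)
    (eq_zero_of_forall_inner_halfLineDerivGraph hd) (fun t => c * V t) (hV.memLp_halfLine d c) l
  refine h.trans ((hG.forall_mem_iff _ l).trans ?_)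
  refine forall_congr' fun f => forall_congr' fun f' => imp_congr_right fun _ =>
    imp_congr_right fun _ => imp_congr_left ?_
  exact ⟨fun H a b ha hab => H ⟨(a, b), ha, hab⟩, fun H i => H i.1.1 i.1.2 i.2.1 i.2.2⟩

/-! ## The level structure of regular trees -/

namespace MetricTree

universe u

variable (Γ : MetricTree.{u})

/-- The vertices of level `n`. -/
abbrev Level (n : ℕ) : Type u := {v : Γ.Vert // Γ.level v = n}

variable {Γ}

theorem level_eq_zero {v : Γ.Vert} : Γ.level v = 0 ↔ v = Γ.root := by
  constructor
  · intro h
    by_contra hv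
    have := Γ.level_eq hv
    omega
  · rintro rfl
    exact Γ.level_root

theorem Level.ne_root {n : ℕ} (v : Γ.Level (n + 1)) : v.1 ≠ Γ.root := fun h => by
  have := v.2
  rw [level_eq_zero.2 h] at this
  omega

theorem Level.level_parent {n : ℕ} (v : Γ.Level (n + 1)) : Γ.level (Γ.parent v.1) = n := by
  have := Γ.level_eq v.ne_root
  have := v.2
  omega

/-- The edge ending at a vertex different from the root. -/
abbrev Level.edge {n : ℕ} (v : Γ.Level (n + 1)) : Γ.Edge := ⟨v.1, v.ne_root⟩

theorem branching_vertPoint (v : Γ.Vert) : Γ.branching (Γ.vertPoint v) = Γ.numChildren v := by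
  simp [branching, vertPoint, Point.abs]

theorem IsProper.exists_child (h : Γ.IsProper) (v : Γ.Vert) :
    ∃ w, w ≠ Γ.root ∧ Γ.parent w = v := by
  have : 0 < Γ.numChildren v := by
    rw [← branching_vertPoint]
    by_cases hv : v = Γ.root
    · rw [hv, h.1]; exact one_pos
    · exact one_pos.trans (h.2 v hv)
  exact Set.nonempty_of_encard_ne_zero this.ne'

theorem IsProper.nonempty_level (h : Γ.IsProper) (n : ℕ) : Nonempty (Γ.Level n) := by
  induction n with
  | zero => exact ⟨⟨Γ.root, Γ.level_root⟩⟩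
  | succ n ih =>
    obtain ⟨v⟩ := ih
    obtain ⟨w, hw, hwv⟩ := h.exists_child v.1
    exact ⟨⟨w, by rw [Γ.level_eq hw, hwv, v.2]⟩⟩

/-- If the edge to `w` were longer than the edge to `v`, it would have an interior point at the
height of `v`. That point has branching number one, while `v` has more. -/
theorem IsRegular.height_le (hreg : Γ.IsRegular) (h : Γ.IsProper) {v w : Γ.Vert}
    (hv : v ≠ Γ.root) (hp : Γ.height (Γ.parent v) = Γ.height (Γ.parent w)) (hw : w ≠ Γ.root) :
    Γ.height w ≤ Γ.height v := by
  by_contra hlt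
  push Not at hlt
  have h1 := Γ.height_eq hv
  have h2 := Γ.len_pos v hv
  let y : Γ.Point := ⟨⟨w, Γ.height v⟩, Or.inr ⟨hw, by rw [← hp]; linarith, hlt.le⟩⟩
  have h3 := hreg (Γ.vertPoint v) y rfl
  have h4 : Γ.branching y = 1 := by
    exact if_neg hlt.ne
  have h5 := h.2 v hv
  rw [h3, h4] at h5
  exact lt_irrefl _ h5

theorem IsRegular.height_eq_of_level_eq (hreg : Γ.IsRegular) (h : Γ.IsProper) (n : ℕ) :
    ∀ v w : Γ.Vert, Γ.level v = n → Γ.level w = n → Γ.height v = Γ.height w := by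
  induction n with
  | zero =>
    intro v w hv hw
    rw [level_eq_zero.1 hv, level_eq_zero.1 hw]
  | succ n ih =>
    intro v w hv hw
    have hp := ih _ _ (Level.level_parent ⟨v, hv⟩) (Level.level_parent ⟨w, hw⟩)
    have hv' := Level.ne_root ⟨v, hv⟩
    have hw' := Level.ne_root ⟨w, hw⟩
    exact le_antisymm (hreg.height_le h hw' hp.symm hv') (hreg.height_le h hv' hp hw')

/-- The vertices of level `n` are finitely many, but not zero, they have height `h n` with
`h n → ∞`, and each of them has `b n` children. -/
structure IsLeveled (Γ : MetricTree.{u}) (h : ℕ → ℝ) (b : ℕ → ℕ) : Prop where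
  strictMono : StrictMono h
  zero : h 0 = 0
  height : ∀ v, Γ.height v = h (Γ.level v)
  not_bddAbove : ¬ BddAbove (range h)
  finite : ∀ n, Finite (Γ.Level n)
  nonempty : ∀ n, Nonempty (Γ.Level n)
  ncard_children : ∀ v, {w : Γ.Vert | w ≠ Γ.root ∧ Γ.parent w = v}.ncard = b (Γ.level v)

theorem mem_Ioc_of_abs_pos (x : Γ.Point) (hx : 0 < x.abs) :
    x.1.1 ≠ Γ.root ∧ x.abs ∈ Ioc (Γ.height (Γ.parent x.1.1)) (Γ.height x.1.1) := by
  rcases x.2 with h | h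
  · exact absurd h.2 hx.ne'
  · exact h

/-- The points at distance `t` from the root, for `t` between the heights of two consecutive
levels. -/
def sphereEquiv {h : ℕ → ℝ} (hm : StrictMono h) (h0 : h 0 = 0)
    (hh : ∀ v, Γ.height v = h (Γ.level v)) {n : ℕ} {t : ℝ} (ht : t ∈ Ioc (h n) (h (n + 1))) :
    {x : Γ.Point // x.abs = t} ≃ Γ.Level (n + 1) where
  toFun x := ⟨x.1.1.1, by
    have hpos : 0 < x.1.abs := by
      rw [x.2]; exact lt_of_le_of_lt (by rw [← h0]; exact hm.monotone (Nat.zero_le n)) ht.1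
    obtain ⟨h1, h2⟩ := mem_Ioc_of_abs_pos x.1 hpos
    rw [x.2, hh, hh] at h2
    have h3 := Γ.level_eq h1
    have h4 := hm.lt_iff_lt.1 (h2.1.trans_le ht.2)
    have h5 := hm.lt_iff_lt.1 (ht.1.trans_le h2.2)
    omega⟩
  invFun v := ⟨⟨⟨v.1, t⟩, Or.inr ⟨v.ne_root, by
    simp only [hh, v.level_parent, v.2]; exact ht⟩⟩, rfl⟩
  left_inv x := by
    obtain ⟨x, rfl⟩ := x
    rfl
  right_inv v := rfl

/-- Positivity of the branching function does double duty. An infinite sphere would have `ncard`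
zero, so levels are finite. If all heights were at most `T`, a point at distance `T` would lie on an
edge whose end has height at least `T`, and the next level would exceed `T`. -/
theorem exists_isLeveled (hΓ : Γ.IsProper) (hreg : Γ.IsRegular)
    (hpos : ∀ t, 0 ≤ t → 0 < Γ.branchingFun t) : ∃ h b, Γ.IsLeveled h b := by
  classical
  have hne := hΓ.nonempty_level
  let c : ∀ n, Γ.Level n := fun n => (hne n).some
  set h : ℕ → ℝ := fun n => Γ.height (c n).1 with hdef
  have hh : ∀ v, Γ.height v = h (Γ.level v) := fun v =>
    hreg.height_eq_of_level_eq hΓ _ _ _ rfl (c _).2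
  have h0 : h 0 = 0 := by
    rw [hdef]
    simp only [level_eq_zero.1 (c 0).2, Γ.height_root]
  have hm : StrictMono h := by
    refine strictMono_nat_of_lt_succ fun n => ?_
    have h1 := Γ.height_eq (c (n + 1)).ne_root
    have h2 := Γ.len_pos _ (c (n + 1)).ne_root
    rw [hh (Γ.parent _), (c (n + 1)).level_parent] at h1
    change h n < Γ.height (c (n + 1)).1
    linarith
  have hcard : ∀ n, Finite (Γ.Level (n + 1)) := by
    intro n
    have ht : h (n + 1) ∈ Ioc (h n) (h (n + 1)) := ⟨hm n.lt_succ_self, le_rfl⟩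
    have hg := hpos (h (n + 1)) (by rw [← h0]; exact hm.monotone (Nat.zero_le _))
    have hfin : {x : Γ.Point | x.abs = h (n + 1)}.Finite := Set.finite_of_ncard_pos hg
    have : Finite {x : Γ.Point // x.abs = h (n + 1)} := hfin.to_subtype
    exact Finite.of_equiv _ (sphereEquiv hm h0 hh ht)
  refine ⟨h, fun n => {w : Γ.Vert | w ≠ Γ.root ∧ Γ.parent w = c n}.ncard, hm, h0, hh, ?_, ?_, hne,
    ?_⟩
  · rintro ⟨T, hT⟩
    have hT' : ∀ n, h n ≤ T := fun n => hT ⟨n, rfl⟩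
    have h1 : h 0 < h 1 := hm one_pos
    have hTpos : 0 < T := by rw [← h0]; exact h1.trans_le (hT' 1)
    obtain ⟨x, hx⟩ := Set.nonempty_of_ncard_ne_zero (hpos T hTpos.le).ne'
    have hx' : x.abs = T := hx
    obtain ⟨-, -, h3⟩ := mem_Ioc_of_abs_pos x (by rw [hx']; exact hTpos)
    rw [hx', hh] at h3
    exact absurd (h3.trans_lt (hm (Nat.lt_succ_self _))) (not_lt.2 (hT' _))
  · intro n
    cases n with
    | succ n => exact hcard n
    | zero =>
      have : Subsingleton (Γ.Level 0) :=
        ⟨fun v w => Subtype.ext ((level_eq_zero.1 v.2).trans (level_eq_zero.1 w.2).symm)⟩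
      infer_instance
  · intro v
    have h1 := hreg (Γ.vertPoint v) (Γ.vertPoint (c (Γ.level v)).1) (hh v)
    rw [branching_vertPoint, branching_vertPoint] at h1
    exact congrArg ENat.toNat h1

namespace IsLeveled

variable {h : ℕ → ℝ} {b : ℕ → ℕ}

theorem nonneg (H : Γ.IsLeveled h b) (n : ℕ) : 0 ≤ h n := by
  rw [← H.zero]; exact H.strictMono.monotone (Nat.zero_le _)

theorem lt_succ (H : Γ.IsLeveled h b) (n : ℕ) : h n < h (n + 1) := H.strictMono n.lt_succ_self

theorem height_level (H : Γ.IsLeveled h b) {n : ℕ} (v : Γ.Level n) : Γ.height v.1 = h n := by rw [H.height, v.2]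

theorem height_parent (H : Γ.IsLeveled h b) {n : ℕ} (v : Γ.Level (n + 1)) : Γ.height (Γ.parent v.1) = h n := by
  rw [H.height, v.level_parent]

theorem iUnion_Ioc (H : Γ.IsLeveled h b) : ⋃ n, Ioc (h n) (h (n + 1)) = Ioi 0 := by
  have := iUnion_Ioc_map_succ_eq_Ioi (f := h) (fun a => H.strictMono.monotone bot_le) H.not_bddAbove
  rw [bot_eq_zero, H.zero] at this
  exact this

theorem branchingFun_eq (H : Γ.IsLeveled h b) {n : ℕ} {t : ℝ} (ht : t ∈ Ioc (h n) (h (n + 1))) :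
    Γ.branchingFun t = Nat.card (Γ.Level (n + 1)) :=
  (Nat.card_coe_set_eq _).symm.trans
    (Nat.card_congr (sphereEquiv H.strictMono H.zero H.height ht))

theorem card_pos (H : Γ.IsLeveled h b) (n : ℕ) : 0 < Nat.card (Γ.Level n) := by
  have := H.finite n
  have := H.nonempty n
  exact Nat.card_pos

theorem sum_parent (H : Γ.IsLeveled h b) (n : ℕ) (F : Γ.Vert → ℝ) [Fintype (Γ.Level n)] [Fintype (Γ.Level (n + 1))] :
    ∑ w : Γ.Level (n + 1), F (Γ.parent w.1) = b n * ∑ v : Γ.Level n, F v.1 := by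
  classical
  let π : Γ.Level (n + 1) → Γ.Level n := fun w => ⟨Γ.parent w.1, w.level_parent⟩
  have h1 : ∑ w : Γ.Level (n + 1), F (Γ.parent w.1) = ∑ w : Γ.Level (n + 1), F (π w).1 := rfl
  rw [h1, ← Finset.sum_fiberwise_of_maps_to (s := Finset.univ) (t := Finset.univ) (g := π)
    (fun _ _ => Finset.mem_univ _), Finset.mul_sum]
  refine Finset.sum_congr rfl fun v _ => ?_
  have h2 : ∀ w ∈ Finset.univ.filter (fun w => π w = v), F (π w).1 = F v.1 := by
    intro w hw
    rw [(Finset.mem_filter.1 hw).2]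
  rw [Finset.sum_congr rfl h2, Finset.sum_const, nsmul_eq_mul]
  congr 2
  have h3 := H.ncard_children v.1
  rw [v.2] at h3
  rw [← h3, ← Set.ncard_coe_finset,
    ← Set.ncard_image_of_injective _ (Subtype.val_injective (p := fun v => Γ.level v = n + 1))]
  congr 1
  ext w
  simp only [mem_image, Finset.mem_coe, Finset.mem_filter, Finset.mem_univ, true_and]
  constructor
  · rintro ⟨w, hw, rfl⟩
    exact ⟨Level.ne_root w, congrArg Subtype.val hw⟩
  · rintro ⟨hw, hwv⟩
    exact ⟨⟨w, by rw [Γ.level_eq hw, hwv, v.2]⟩, Subtype.ext hwv, rfl⟩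

/-- Each vertex of level `n` is counted `b n` times in the sum, and `b n` is also the ratio of the
cardinalities. This is why spherical means do not jump at vertices. -/
theorem sum_parent_div_card (H : Γ.IsLeveled h b) (n : ℕ) (F : Γ.Vert → ℝ) [Fintype (Γ.Level n)]
    [Fintype (Γ.Level (n + 1))] :
    (∑ w : Γ.Level (n + 1), F (Γ.parent w.1)) / Nat.card (Γ.Level (n + 1)) =
      (∑ v : Γ.Level n, F v.1) / Nat.card (Γ.Level n) := by
  have h1 := H.sum_parent n F
  have h2 := H.sum_parent n (fun _ => 1)
  have h3 : (0 : ℝ) < Nat.card (Γ.Level (n + 1)) := by exact_mod_cast H.card_pos (n + 1)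
  have h4 : (0 : ℝ) < Nat.card (Γ.Level n) := by exact_mod_cast H.card_pos n
  simp only [Finset.sum_const, Finset.card_univ, nsmul_eq_mul, mul_one,
    ← Nat.card_eq_fintype_card] at h2
  rw [div_eq_div_iff h3.ne' h4.ne', h1, h2]
  ring

end IsLeveled

end MetricTree

namespace MetricTree

universe u

variable {Γ : MetricTree.{u}}

/-! ## The derivative on a metric tree -/

theorem edgePoint_of_mem {e : Γ.Edge} {t : ℝ}
    (ht : t ∈ Ioc (Γ.height (Γ.parent e.1)) (Γ.height e.1)) :
    (Γ.edgePoint e t).1 = ⟨e.1, t⟩ := if_pos ht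

theorem abs_edgePoint {e : Γ.Edge} {t : ℝ}
    (ht : t ∈ Icc (Γ.height (Γ.parent e.1)) (Γ.height e.1)) : (Γ.edgePoint e t).abs = t := by
  by_cases h : t ∈ Ioc (Γ.height (Γ.parent e.1)) (Γ.height e.1)
  · rw [Point.abs, edgePoint_of_mem h]
  · have : t = Γ.height (Γ.parent e.1) := by
      by_contra hne
      exact h ⟨lt_of_le_of_ne ht.1 (Ne.symm hne), ht.2⟩
    subst this
    simp [Point.abs, edgePoint, vertPoint]

theorem edgePoint_left (e : Γ.Edge) :
    Γ.edgePoint e (Γ.height (Γ.parent e.1)) = Γ.vertPoint (Γ.parent e.1) := by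
  apply Subtype.ext
  simp [edgePoint]

theorem height_parent_lt (e : Γ.Edge) : Γ.height (Γ.parent e.1) < Γ.height e.1 := by
  have := Γ.height_eq e.2
  have := Γ.len_pos e.1 e.2
  linarith

theorem vol_eq : Γ.vol = Measure.sum fun e : Γ.Edge =>
    (volume.restrict (Ioc (Γ.height (Γ.parent e.1)) (Γ.height e.1))).map (Γ.edgePoint e) := by
  simp only [vol, restrict_Ioc_eq_restrict_Icc]

theorem isCurveDerivGraph (Γ : MetricTree.{u}) : IsCurveDerivGraph Γ.edgePoint
    (fun e => Γ.height (Γ.parent e.1)) (fun e => Γ.height e.1) Γ.derivGraph where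
  lt := height_parent_lt
  measurable := Γ.measurable_edgePoint
  map_le e := by
    rw [vol_eq]
    exact Measure.le_sum (fun e : Γ.Edge =>
      (volume.restrict (Ioc (Γ.height (Γ.parent e.1)) (Γ.height e.1))).map (Γ.edgePoint e)) e
  mem_iff _ := Iff.rfl

theorem measurableSet_vert_eq (v : Γ.Vert) : MeasurableSet {x : Γ.Point | x.1.1 = v} := by
  have h : MeasurableSet {p : Σ _ : Γ.Vert, ℝ | p.1 = v} := by
    refine MeasurableSpace.measurableSet_iInf.2 fun w => ?_
    change MeasurableSet {t : ℝ | w = v}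
    exact MeasurableSet.const _
  exact measurable_subtype_coe h

theorem restrict_vol_edge (e : Γ.Edge) : Γ.vol.restrict {x | x.1.1 = e.1} =
    (volume.restrict (Ioc (Γ.height (Γ.parent e.1)) (Γ.height e.1))).map (Γ.edgePoint e) := by
  classical
  have hS := measurableSet_vert_eq e.1
  rw [vol_eq, Measure.restrict_sum _ hS]
  have key : ∀ e' : Γ.Edge,
      ((volume.restrict (Ioc (Γ.height (Γ.parent e'.1)) (Γ.height e'.1))).map
        (Γ.edgePoint e')).restrict {x | x.1.1 = e.1} = if e' = e then
      (volume.restrict (Ioc (Γ.height (Γ.parent e.1)) (Γ.height e.1))).map (Γ.edgePoint e)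
      else 0 := by
    intro e'
    rw [Measure.restrict_map (Γ.measurable_edgePoint e') hS,
      Measure.restrict_restrict ((Γ.measurable_edgePoint e') hS)]
    split_ifs with he
    · subst he
      congr 2
      ext t
      simp only [mem_inter_iff, mem_preimage, and_iff_right_iff_imp]
      intro ht
      change (Γ.edgePoint e' t).1.1 = _
      rw [edgePoint_of_mem ht]
    · have : (Γ.edgePoint e' ⁻¹' {x | x.1.1 = e.1}) ∩
          Ioc (Γ.height (Γ.parent e'.1)) (Γ.height e'.1) = ∅ := by
        ext t
        simp only [mem_inter_iff, mem_preimage, mem_empty_iff_false, iff_false, not_and]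
        intro h ht
        change (Γ.edgePoint e' t).1.1 = _ at h
        rw [edgePoint_of_mem ht] at h
        exact he (Subtype.ext h)
      rw [this]
      simp
  simp only [key]
  ext s hs
  rw [Measure.sum_apply _ hs, tsum_eq_single e]
  · simp
  · intro e' he'
    simp [he']

theorem IsLeveled.countable_vert {h : ℕ → ℝ} {b : ℕ → ℕ} (H : Γ.IsLeveled h b) :
    Countable Γ.Vert := by
  have := fun n => H.finite n
  let f : Γ.Vert → Σ n, Γ.Level n := fun v => ⟨Γ.level v, v, rfl⟩
  refine Function.Injective.countable (f := f) fun v w hvw => ?_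
  simp only [f, Sigma.mk.injEq] at hvw
  obtain ⟨h1, h2⟩ := hvw
  exact (Subtype.heq_iff_coe_eq (by rw [h1]; simp)).1 h2

/-- There are countably many edges, so null sets may be checked edge by edge. This is the covering
hypothesis of `snd_eq_zero`. -/
theorem IsLeveled.ae_eq_zero {h : ℕ → ℝ} {b : ℕ → ℕ} (H : Γ.IsLeveled h b) (f : Γ.Point → ℂ)
    (hf : AEStronglyMeasurable f Γ.vol)
    (h0 : ∀ e : Γ.Edge, ∀ᵐ t ∂volume.restrict (Ioc (Γ.height (Γ.parent e.1)) (Γ.height e.1)),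
      f (Γ.edgePoint e t) = 0) : f =ᵐ[Γ.vol] 0 := by
  have := H.countable_vert
  refine hf.ae_eq_mk.trans ?_
  have hms : MeasurableSet {x | hf.mk f x = 0} :=
    hf.stronglyMeasurable_mk.measurable (measurableSet_singleton 0)
  change ∀ᵐ x ∂Γ.vol, hf.mk f x = 0
  have hae := fun e => Γ.isCurveDerivGraph.ae_comp hf.ae_eq_mk e
  generalize hf.mk f = f₀ at hms hae ⊢
  rw [vol_eq, Measure.ae_sum_iff]
  intro e
  rw [ae_map_iff (Γ.measurable_edgePoint e).aemeasurable hms]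
  filter_upwards [h0 e, hae e] with t ht ht'
  rw [← ht', ht]

/-- Smooth functions supported inside one open edge, extended by zero, belong to `H¹(Γ)`. Testing
against them shows that `w` vanishes on every edge. -/
theorem IsLeveled.eq_zero_of_forall_inner {h : ℕ → ℝ} {b : ℕ → ℕ} (H : Γ.IsLeveled h b)
    (w : Lp ℂ 2 Γ.vol) (hw : ∀ p ∈ Γ.derivGraph, inner ℂ p.1 w = 0) : w = 0 := by
  classical
  rw [Lp.eq_zero_iff_ae_eq_zero]
  refine H.ae_eq_zero _ (Lp.memLp w).1 fun e => ?_
  set a := Γ.height (Γ.parent e.1)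
  set c := Γ.height e.1
  have hac : a < c := height_parent_lt e
  have hwe := Γ.isCurveDerivGraph.memLp_comp (Lp.memLp w) e
  have hwi : IntegrableOn (fun t => w (Γ.edgePoint e t)) (Ioc a c) :=
    hwe.integrable (by norm_num)
  have hS := measurableSet_vert_eq e.1
  have key := isOpen_Ioo.ae_eq_zero_of_integral_contDiff_smul_eq_zero (U := Ioo a c)
    (μ := volume) (hwi.mono_set Ioo_subset_Ioc_self).locallyIntegrableOn fun g hg hgc hgU => ?_
  · rw [← restrict_Ioo_eq_restrict_Ioc, ae_restrict_iff' measurableSet_Ioo]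
    exact key
  have hg1 : ContDiff ℝ 1 g := hg.of_le (by norm_num)
  have hg0 : ∀ t, t ∉ Ioo a c → g t = 0 := fun t ht =>
    image_eq_zero_of_notMem_tsupport fun h => ht (hgU h)
  let F : (ℝ → ℝ) → Γ.Point → ℂ := fun k =>
    {x : Γ.Point | x.1.1 = e.1}.indicator fun x => (k x.abs : ℂ)
  have hF : ∀ k : ℝ → ℝ, Continuous k → HasCompactSupport k → MemLp (F k) 2 Γ.vol := by
    intro k hk hkc
    have hkm : Measurable fun x : Γ.Point => (k x.abs : ℂ) :=
      Complex.measurable_ofReal.comp (hk.measurable.comp Γ.measurable_abs)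
    rw [memLp_indicator_iff_restrict hS, restrict_vol_edge,
      memLp_map_measure_iff hkm.aestronglyMeasurable (Γ.measurable_edgePoint e).aemeasurable]
    have h1 : MemLp (fun t => (k t : ℂ)) 2 (volume.restrict (Ioc a c)) :=
      (Complex.continuous_ofReal.comp hk).memLp_of_hasCompactSupport
        (hkc.comp_left Complex.ofReal_zero)
    refine h1.ae_eq ?_
    filter_upwards [ae_restrict_mem measurableSet_Ioc] with t ht
    simp only [Function.comp, abs_edgePoint (Ioc_subset_Icc_self ht)]
  have hFe : ∀ (k : ℝ → ℝ) (e' : Γ.Edge),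
      ∀ t ∈ Ioc (Γ.height (Γ.parent e'.1)) (Γ.height e'.1),
      F k (Γ.edgePoint e' t) = if e' = e then (k t : ℂ) else 0 := by
    intro k e' t ht
    simp only [F, indicator, mem_ofPred_eq, edgePoint_of_mem ht, Subtype.ext_iff]
    rw [abs_edgePoint (Ioc_subset_Icc_self ht)]
  -- At its left end `e'` meets the parent vertex, which may be the upper end of `e`. There `g`
  -- vanishes, so the extension by zero is continuous.
  have hFe' : ∀ (e' : Γ.Edge), ∀ t ∈ Icc (Γ.height (Γ.parent e'.1)) (Γ.height e'.1),
      F g (Γ.edgePoint e' t) = if e' = e then (g t : ℂ) else 0 := by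
    intro e' t ht
    rcases eq_or_lt_of_le ht.1 with h1 | h1
    · subst h1
      rw [edgePoint_left]
      have h2 : F g (Γ.vertPoint (Γ.parent e'.1)) = 0 := by
        simp only [F, indicator, mem_ofPred_eq]
        split_ifs with h3
        · have h4 : (Γ.vertPoint (Γ.parent e'.1)).abs = c := by
            change Γ.height _ = _
            exact congrArg Γ.height h3
          rw [h4, hg0 c (fun h => lt_irrefl _ h.2), Complex.ofReal_zero]
        · rfl
      rw [h2]
      split_ifs with h3
      · subst h3
        rw [hg0 _ (fun h => lt_irrefl _ h.1), Complex.ofReal_zero]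
      · rfl
    · exact hFe g e' t ⟨h1, ht.2⟩
  have h1 := hF g hg.continuous hgc
  have h2 := hF (_root_.deriv g) (hg1.continuous_deriv le_rfl) hgc.deriv
  have h3 := hw (h1.toLp _, h2.toLp _) ⟨_, _, h1.coeFn_toLp, h2.coeFn_toLp, fun e' => by
    by_cases he : e' = e
    · refine (HasACDeriv.of_contDiff hg1 _ _).congr (height_parent_lt e').le (fun t ht => ?_) ?_
      · rw [hFe' e' t ht, if_pos he]
      · filter_upwards [ae_restrict_mem measurableSet_Ioc] with t ht
        rw [hFe _ e' t ht, if_pos he]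
    · refine (HasACDeriv.zero _ _).congr (height_parent_lt e').le (fun t ht => ?_) ?_
      · rw [hFe' e' t ht, if_neg he]
      · filter_upwards [ae_restrict_mem measurableSet_Ioc] with t ht
        rw [hFe _ e' t ht, if_neg he]⟩
  have h4 : ∫ x in {x : Γ.Point | x.1.1 = e.1}, (g x.abs : ℂ) * w x ∂Γ.vol = 0 := by
    rw [L2.inner_def] at h3
    rw [← h3, ← integral_indicator hS]
    refine integral_congr_ae ?_
    filter_upwards [h1.coeFn_toLp] with x hx
    rw [hx]
    simp only [F, indicator, mem_ofPred_eq]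
    split_ifs <;> simp [mul_comm]
  have hgm : AEStronglyMeasurable (fun x : Γ.Point => (g x.abs : ℂ) * w x)
      (Measure.map (Γ.edgePoint e) (volume.restrict (Ioc a c))) :=
    ((Complex.measurable_ofReal.comp (hg.continuous.measurable.comp
      Γ.measurable_abs)).aestronglyMeasurable).mul
      ((Lp.memLp w).1.mono_measure (Γ.isCurveDerivGraph.map_le e))
  rw [restrict_vol_edge, integral_map (Γ.measurable_edgePoint e).aemeasurable hgm] at h4
  rw [← h4, ← setIntegral_eq_integral_of_forall_compl_eq_zero (s := Ioc a c)]
  · refine setIntegral_congr_fun measurableSet_Ioc fun t ht => ?_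
    simp only [abs_edgePoint (e := e) (Ioc_subset_Icc_self ht), Complex.real_smul]
  · intro t ht
    rw [hg0 t fun h => ht (Ioo_subset_Ioc_self h), zero_smul]

/-- The variational principle for the Schrödinger operators on a regular tree. -/
theorem IsLeveled.le_infSpec_schrodingerOperator_iff {h : ℕ → ℝ} {b : ℕ → ℕ}
    (H : Γ.IsLeveled h b) (V : ℝ → ℝ) (hV : IsBoundedPotential V) (α l : ℝ) :
    (l : EReal) ≤ infSpec (Γ.schrodingerOperator V hV α) ↔
      ∀ f f' : Γ.Point → ℂ, MemLp f 2 Γ.vol → MemLp f' 2 Γ.vol →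
        (∀ e : Γ.Edge, HasACDeriv (fun t => f (Γ.edgePoint e t)) (fun t => f' (Γ.edgePoint e t))
          (Γ.height (Γ.parent e.1)) (Γ.height e.1)) →
        l * ∫ x, ‖f x‖ ^ 2 ∂Γ.vol ≤
          (∫ x, ‖f' x‖ ^ 2 ∂Γ.vol) - ∫ x, α * V x.abs * ‖f x‖ ^ 2 ∂Γ.vol :=
  (le_infSpec_energyForm_sub_iff Γ.isCurveDerivGraph.isClosed
    (Γ.isCurveDerivGraph.snd_eq_zero H.ae_eq_zero) H.eq_zero_of_forall_inner
    (fun x : Γ.Point => α * V x.abs) (Γ.memLp_radial hV α) l).trans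
    (Γ.isCurveDerivGraph.forall_mem_iff _ l)

end MetricTree

/-! ### A criterion for absolute continuity -/

/-- A real function whose increments are controlled by the integral of `G` is absolutely
continuous, with derivative bounded by `G`. -/
theorem hasACDeriv_of_abs_sub_le {φ G : ℝ → ℝ} {a b : ℝ} (hab : a ≤ b)
    (hG : IntervalIntegrable G volume a b)
    (h : ∀ s ∈ Icc a b, ∀ t ∈ Icc a b, s ≤ t → |φ t - φ s| ≤ ∫ r in s..t, G r) :
    HasACDeriv (fun t => (φ t : ℂ)) (fun t => ((_root_.deriv φ t : ℝ) : ℂ)) a b ∧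
      ∀ᵐ t ∂volume.restrict (Ioc a b), |_root_.deriv φ t| ≤ G t := by
  have haa : a ∈ Icc a b := ⟨le_rfl, hab⟩
  have hsub : ∀ s ∈ Icc a b, ∀ t ∈ Icc a b,
      ∫ r in s..t, G r = (∫ r in a..t, G r) - ∫ r in a..s, G r := by
    intro s hs t ht
    refine (intervalIntegral.integral_interval_sub_left ?_ ?_).symm <;>
    · refine hG.mono_set ?_
      rw [uIcc_of_le hab]
      exact uIcc_subset_Icc haa (by assumption)
  have hI := hG.absolutelyContinuousOnInterval_intervalIntegral (c := a) (by simp)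
  have hdist : ∀ s ∈ Icc a b, ∀ t ∈ Icc a b,
      dist (φ s) (φ t) ≤ dist (∫ r in a..s, G r) (∫ r in a..t, G r) := by
    intro s hs t ht
    rcases le_total s t with hst | hst
    · rw [dist_comm, dist_comm (∫ r in a..s, G r), Real.dist_eq, Real.dist_eq, ← hsub s hs t ht]
      exact (h s hs t ht hst).trans (le_abs_self _)
    · rw [Real.dist_eq, Real.dist_eq, ← hsub t ht s hs]
      exact (h t ht s hs hst).trans (le_abs_self _)
  -- Increments of `φ` are dominated by those of the primitive of `G`, which is absolutely
  -- continuous.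
  have hAC : AbsolutelyContinuousOnInterval φ a b := by
    refine squeeze_zero' (Eventually.of_forall fun E => Finset.sum_nonneg fun _ _ => dist_nonneg)
      ?_ hI
    refine eventually_inf_principal.2 (Eventually.of_forall fun E hE => ?_)
    refine Finset.sum_le_sum fun i hi => ?_
    have := hE.1 i hi
    rw [uIcc_of_le hab] at this
    exact hdist _ this.1 _ this.2
  have hmono : ∀ t ∈ Icc a b, uIcc a t ⊆ uIcc a b := fun t ht => by
    rw [uIcc_of_le hab]; exact uIcc_subset_Icc haa ht
  refine ⟨⟨?_, fun t ht => ?_⟩, ?_⟩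
  · have := hAC.intervalIntegrable_deriv
    exact ⟨this.1.ofReal, this.2.ofReal⟩
  · rw [intervalIntegral.integral_ofReal, (hAC.mono (hmono t ht)).integral_deriv_eq_sub]
    push_cast; ring
  · have h1 : ∀ᵐ x : ℝ, x ≠ b := by simp [ae_iff, measure_singleton]
    rw [ae_restrict_iff' measurableSet_Ioc]
    filter_upwards [hAC.ae_differentiableAt, hG.ae_hasDerivAt_integral, h1] with x hx1 hx2 hxb hxm
    have hxi : x ∈ Icc a b := Ioc_subset_Icc_self hxm
    have hxu : x ∈ uIcc a b := by rwa [uIcc_of_le hab]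
    have d1 := (hx1 hxu).hasDerivAt
    have d2 := hx2 hxu a (by simp)
    have s1 := (hasDerivAt_iff_tendsto_slope.1 d1).mono_left
      (nhdsWithin_mono x (s := Ioi x) fun y hy => (mem_Ioi.1 hy).ne')
    have s2 := (hasDerivAt_iff_tendsto_slope.1 d2).mono_left
      (nhdsWithin_mono x (s := Ioi x) fun y hy => (mem_Ioi.1 hy).ne')
    -- At almost every point both derivatives exist, and the inequality between right difference
    -- quotients passes to the limit.
    refine le_of_tendsto_of_tendsto s1.abs s2 ?_
    have hxlt : x < b := lt_of_le_of_ne hxm.2 hxb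
    filter_upwards [Ioo_mem_nhdsGT hxlt] with y hy
    have hyi : y ∈ Icc a b := ⟨hxi.1.trans hy.1.le, hy.2.le⟩
    have hpos : 0 < y - x := sub_pos.2 hy.1
    rw [slope_def_field, slope_def_field, abs_div, abs_of_pos hpos, ← hsub x hxi y hyi]
    gcongr
    exact h x hxi y hyi hy.1.le

namespace MetricTree

universe u

variable {Γ : MetricTree.{u}} {h : ℕ → ℝ} {b : ℕ → ℕ}

/-! ## Averages over spheres -/

/-- The average of `F` over the points at distance `t` from the root. -/
noncomputable def sphereAvg (F : Γ.Point → ℝ) (t : ℝ) : ℝ :=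
  (∑ᶠ x : {x : Γ.Point // x.abs = t}, F x) / Γ.branchingFun t

theorem edgePoint_val_of_mem (H : Γ.IsLeveled h b) {n : ℕ} (v : Γ.Level (n + 1)) {t : ℝ}
    (ht : t ∈ Ioc (h n) (h (n + 1))) : (Γ.edgePoint v.edge t).1 = ⟨v.1, t⟩ := by
  refine edgePoint_of_mem ?_
  rw [H.height_parent, H.height_level]
  exact ht

theorem IsLeveled.bijective_vertPoint (H : Γ.IsLeveled h b) (n : ℕ) :
    Function.Bijective fun v : Γ.Level n =>
      (⟨Γ.vertPoint v.1, H.height_level v⟩ : {x : Γ.Point // x.abs = h n}) := by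
  constructor
  · intro v w hvw
    have := congrArg (fun x : {x : Γ.Point // x.abs = h n} => x.1.1.1) hvw
    exact Subtype.ext this
  · rintro ⟨⟨⟨v, t⟩, hx⟩, ht⟩
    change t = h n at ht
    subst ht
    have hv : Γ.level v = n := by
      rcases hx with ⟨h1, h2⟩ | ⟨h1, h2, h3⟩
      · change v = _ at h1
        change h n = 0 at h2
        rw [level_eq_zero.2 h1]
        exact H.strictMono.injective (by rw [H.zero, h2])
      · change v ≠ _ at h1
        change _ < h n at h2
        change h n ≤ _ at h3
        rw [H.height] at h2 h3
        have h4 := H.strictMono.lt_iff_lt.1 h2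
        have h5 := H.strictMono.le_iff_le.1 h3
        have h6 := Γ.level_eq h1
        simp only at h4 h5
        omega
    refine ⟨⟨v, hv⟩, Subtype.ext (Subtype.ext ?_)⟩
    simp only [vertPoint]
    rw [H.height, hv]

/-- The left endpoint `h n` is included on purpose. There the sphere consists of the vertices of
level `n`, while the sum runs over the more numerous edges above them; `sum_parent_div_card` says
that the means agree. Hence the formula holds on closed intervals and the pieces can be glued. -/
theorem IsLeveled.sphereAvg_eq (H : Γ.IsLeveled h b) (F : Γ.Point → ℝ) {n : ℕ} {t : ℝ}
    (ht : t ∈ Icc (h n) (h (n + 1))) [Fintype (Γ.Level (n + 1))] :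
    sphereAvg F t =
      (∑ v : Γ.Level (n + 1), F (Γ.edgePoint v.edge t)) / Nat.card (Γ.Level (n + 1)) := by
  rcases eq_or_lt_of_le ht.1 with h1 | h1
  · subst h1
    have := H.finite n
    have := Fintype.ofFinite (Γ.Level n)
    have h2 : ∀ v : Γ.Level (n + 1), F (Γ.edgePoint v.edge (h n)) =
        F (Γ.vertPoint (Γ.parent v.1)) := fun v => by
      rw [← edgePoint_left v.edge, H.height_parent]
    simp only [h2]
    rw [H.sum_parent_div_card n fun v => F (Γ.vertPoint v), sphereAvg]
    have h3 : Γ.branchingFun (h n) = Nat.card (Γ.Level n) :=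
      (Nat.card_coe_set_eq _).symm.trans
        (Nat.card_congr (Equiv.ofBijective _ (H.bijective_vertPoint n))).symm
    rw [h3, ← finsum_comp_equiv (Equiv.ofBijective _ (H.bijective_vertPoint n)),
      finsum_eq_sum_of_fintype]
    rfl
  · have ht' : t ∈ Ioc (h n) (h (n + 1)) := ⟨h1, ht.2⟩
    rw [sphereAvg, H.branchingFun_eq ht',
      ← finsum_comp_equiv (sphereEquiv H.strictMono H.zero H.height ht').symm,
      finsum_eq_sum_of_fintype]
    congr 1
    refine Finset.sum_congr rfl fun v _ => congrArg F (Subtype.ext ?_)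
    rw [edgePoint_val_of_mem H v ht']
    rfl

theorem IsLeveled.exists_mem_Ioc (H : Γ.IsLeveled h b) {t : ℝ} (ht : 0 < t) :
    ∃ n, t ∈ Ioc (h n) (h (n + 1)) := by
  have : t ∈ ⋃ n, Ioc (h n) (h (n + 1)) := by rw [H.iUnion_Ioc]; exact ht
  exact mem_iUnion.1 this

theorem IsLeveled.abs_edgePoint_level (H : Γ.IsLeveled h b) {n : ℕ} (v : Γ.Level (n + 1)) {t : ℝ}
    (ht : t ∈ Icc (h n) (h (n + 1))) : (Γ.edgePoint v.edge t).abs = t := by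
  refine abs_edgePoint ?_
  rw [H.height_parent, H.height_level]
  exact ht

theorem IsLeveled.sphereAvg_radial_mul (H : Γ.IsLeveled h b) (k : ℝ → ℝ) (F : Γ.Point → ℝ) {t : ℝ}
    (ht : 0 < t) : sphereAvg (fun x => k x.abs * F x) t = k t * sphereAvg F t := by
  obtain ⟨n, hn⟩ := H.exists_mem_Ioc ht
  have := H.finite (n + 1)
  have := Fintype.ofFinite (Γ.Level (n + 1))
  have hn' := Ioc_subset_Icc_self hn
  rw [H.sphereAvg_eq _ hn', H.sphereAvg_eq _ hn']
  simp only [H.abs_edgePoint_level _ hn']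
  rw [← Finset.mul_sum, mul_div_assoc]

theorem IsLeveled.sphereAvg_radial (H : Γ.IsLeveled h b) (k : ℝ → ℝ) {t : ℝ} (ht : 0 < t) :
    sphereAvg (fun x : Γ.Point => k x.abs) t = k t := by
  obtain ⟨n, hn⟩ := H.exists_mem_Ioc ht
  have := H.finite (n + 1)
  have := Fintype.ofFinite (Γ.Level (n + 1))
  have hn' := Ioc_subset_Icc_self hn
  have hc : (Nat.card (Γ.Level (n + 1)) : ℝ) ≠ 0 := by exact_mod_cast (H.card_pos (n + 1)).ne'
  rw [H.sphereAvg_eq _ hn']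
  simp only [H.abs_edgePoint_level _ hn', Finset.sum_const, Finset.card_univ, nsmul_eq_mul]
  rw [← Nat.card_eq_fintype_card]
  field_simp

theorem sphereAvg_nonneg {F : Γ.Point → ℝ} (hF : ∀ x, 0 ≤ F x) (t : ℝ) : 0 ≤ sphereAvg F t :=
  div_nonneg (finsum_nonneg fun x => hF x) (Nat.cast_nonneg _)

theorem lintegral_vol {F : Γ.Point → ℝ≥0∞} (hF : AEMeasurable F Γ.vol) :
    ∫⁻ x, F x ∂Γ.vol = ∑' e : Γ.Edge,
      ∫⁻ t in Ioc (Γ.height (Γ.parent e.1)) (Γ.height e.1), F (Γ.edgePoint e t) := by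
  conv_lhs => rw [vol_eq, lintegral_sum_measure]
  refine tsum_congr fun e => ?_
  exact lintegral_map' (hF.mono_measure (Γ.isCurveDerivGraph.map_le e))
    (Γ.measurable_edgePoint e).aemeasurable

/-- The edges, sorted by the level of their endpoints. -/
noncomputable def levelEquivEdge (Γ : MetricTree.{u}) : (Σ n, Γ.Level (n + 1)) ≃ Γ.Edge where
  toFun v := v.2.edge
  invFun e := ⟨Γ.level (Γ.parent e.1), e.1, Γ.level_eq e.2⟩
  left_inv := by
    rintro ⟨n, v, hv⟩
    exact Sigma.subtype_ext (Level.level_parent ⟨v, hv⟩) rfl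
  right_inv _ := rfl

/-- Integration over the tree in polar coordinates. -/
theorem IsLeveled.lintegral_vol_eq (H : Γ.IsLeveled h b) {F : Γ.Point → ℝ}
    (hF : AEMeasurable F Γ.vol) (hF0 : ∀ x, 0 ≤ F x) :
    ∫⁻ x, ENNReal.ofReal (F x) ∂Γ.vol =
      ∫⁻ t in Ioi 0, Γ.branchingFun t * ENNReal.ofReal (sphereAvg F t) := by
  have hdisj : Pairwise (Function.onFun Disjoint fun n => Ioc (h n) (h (n + 1))) :=
    H.strictMono.monotone.pairwise_disjoint_on_Ioc_succ
  rw [lintegral_vol hF.ennreal_ofReal, ← Equiv.tsum_eq (levelEquivEdge Γ), ENNReal.tsum_sigma',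
    ← H.iUnion_Ioc, lintegral_iUnion (fun _ => measurableSet_Ioc) hdisj]
  refine tsum_congr fun n => ?_
  have := H.finite (n + 1)
  have := Fintype.ofFinite (Γ.Level (n + 1))
  rw [tsum_fintype]
  have hterm : ∀ v : Γ.Level (n + 1),
      AEMeasurable (fun t => ENNReal.ofReal (F (Γ.edgePoint v.edge t)))
        (volume.restrict (Ioc (h n) (h (n + 1)))) := by
    intro v
    have := (hF.mono_measure (Γ.isCurveDerivGraph.map_le v.edge)).comp_measurable
      (Γ.measurable_edgePoint v.edge)
    simp only [H.height_parent, H.height_level] at this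
    exact this.ennreal_ofReal
  have hset : ∀ v : Γ.Level (n + 1),
      ∫⁻ t in Ioc (Γ.height (Γ.parent v.edge.1)) (Γ.height v.edge.1),
        ENNReal.ofReal (F (Γ.edgePoint v.edge t)) =
      ∫⁻ t in Ioc (h n) (h (n + 1)), ENNReal.ofReal (F (Γ.edgePoint v.edge t)) := fun v => by
    rw [H.height_parent, H.height_level]
  change ∑ v : Γ.Level (n + 1), ∫⁻ t in Ioc (Γ.height (Γ.parent v.edge.1)) (Γ.height v.edge.1),
        ENNReal.ofReal (F (Γ.edgePoint v.edge t)) = _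
  simp only [hset]
  rw [← lintegral_finsetSum' _ fun v _ => hterm v]
  refine setLIntegral_congr_fun measurableSet_Ioc fun t ht => ?_
  have hc : (0 : ℝ) < Nat.card (Γ.Level (n + 1)) := by exact_mod_cast H.card_pos (n + 1)
  rw [H.branchingFun_eq ht, H.sphereAvg_eq F (Ioc_subset_Icc_self ht), ← ENNReal.ofReal_natCast,
    ← ENNReal.ofReal_mul hc.le, mul_div_cancel₀ _ hc.ne', ENNReal.ofReal_sum_of_nonneg]
  exact fun v _ => hF0 _

/-- The root mean square over spheres of a function on the tree which is absolutely continuous on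
each edge is absolutely continuous between consecutive levels. -/
theorem IsLeveled.hasACDeriv_sqrt_sphereAvg_succ (H : Γ.IsLeveled h b) {f f' : Γ.Point → ℂ}
    (hac : ∀ e : Γ.Edge, HasACDeriv (fun t => f (Γ.edgePoint e t)) (fun t => f' (Γ.edgePoint e t))
      (Γ.height (Γ.parent e.1)) (Γ.height e.1)) (n : ℕ) :
    HasACDeriv (fun t => (√(sphereAvg (fun x => ‖f x‖ ^ 2) t) : ℂ))
      (fun t => ((_root_.deriv (fun t => √(sphereAvg (fun x => ‖f x‖ ^ 2) t)) t : ℝ) : ℂ))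
      (h n) (h (n + 1)) ∧
    ∀ᵐ t ∂volume.restrict (Ioc (h n) (h (n + 1))),
      |_root_.deriv (fun t => √(sphereAvg (fun x => ‖f x‖ ^ 2) t)) t| ≤
        √(sphereAvg (fun x => ‖f' x‖ ^ 2) t) := by
  have := H.finite (n + 1)
  have := Fintype.ofFinite (Γ.Level (n + 1))
  have hle := (H.lt_succ n).le
  have hac' : ∀ v : Γ.Level (n + 1), HasACDeriv (fun t => f (Γ.edgePoint v.edge t))
      (fun t => f' (Γ.edgePoint v.edge t)) (h n) (h (n + 1)) := fun v => by
    have := hac v.edge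
    rwa [H.height_parent, H.height_level] at this
  -- The values on a sphere form a Euclidean vector, and the root mean square is its norm over `√N`.
  -- Since `vec f` has increments `∫ vec f'`, the triangle inequality for norms and integrals bounds
  -- the increments of the root mean square.
  let vec : (Γ.Point → ℂ) → ℝ → EuclideanSpace ℂ (Γ.Level (n + 1)) := fun k t =>
    WithLp.toLp 2 fun v => k (Γ.edgePoint v.edge t)
  set N : ℝ := ((Nat.card (Γ.Level (n + 1)) : ℕ) : ℝ) with hN
  have hrms : ∀ (k : Γ.Point → ℂ), ∀ t ∈ Icc (h n) (h (n + 1)),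
      √(sphereAvg (fun x => ‖k x‖ ^ 2) t) = ‖vec k t‖ / √N := by
    intro k t ht
    rw [H.sphereAvg_eq _ ht, Real.sqrt_div' _ (Nat.cast_nonneg _), EuclideanSpace.norm_eq]
  have hvint : IntegrableOn (vec f') (Ioc (h n) (h (n + 1))) := by
    refine Integrable.of_eval_piLp fun v => ?_
    exact (intervalIntegrable_iff_integrableOn_Ioc_of_le hle).1 (hac' v).1
  refine hasACDeriv_of_abs_sub_le hle ?_ fun s hs t ht hst => ?_
  · rw [intervalIntegrable_iff_integrableOn_Ioc_of_le hle]
    refine (integrableOn_congr_fun (fun t ht => hrms f' t (Ioc_subset_Icc_self ht))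
      measurableSet_Ioc).2 ?_
    exact hvint.norm.div_const _
  · have h1 : ∫ r in s..t, √(sphereAvg (fun x => ‖f' x‖ ^ 2) r) = ∫ r in s..t, ‖vec f' r‖ / √N := by
      refine intervalIntegral.integral_congr fun r hr => ?_
      rw [uIcc_of_le hst] at hr
      exact hrms f' r ⟨hs.1.trans hr.1, hr.2.trans ht.2⟩
    have h2 : vec f t - vec f s = ∫ r in s..t, vec f' r := by
      rw [intervalIntegral.integral_of_le hst]
      ext v
      rw [eval_integral_piLp]
      · rw [← intervalIntegral.integral_of_le hst]
        exact (hac' v).sub_eq hs ht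
      · intro v
        exact (intervalIntegrable_iff_integrableOn_Ioc_of_le hst).1
          ((hac' v).intervalIntegrable hs ht)
    rw [h1, hrms f t ht, hrms f s hs, intervalIntegral.integral_div, ← sub_div, abs_div,
      abs_of_nonneg (Real.sqrt_nonneg N)]
    gcongr
    refine (abs_norm_sub_norm_le _ _).trans ?_
    rw [h2]
    exact intervalIntegral.norm_integral_le_integral_norm hst

/-- The intervals between consecutive levels are glued by induction; the heights are unbounded, so
every `[a, c]` is reached. -/
theorem IsLeveled.hasACDeriv_sqrt_sphereAvg (H : Γ.IsLeveled h b) {f f' : Γ.Point → ℂ}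
    (hac : ∀ e : Γ.Edge, HasACDeriv (fun t => f (Γ.edgePoint e t)) (fun t => f' (Γ.edgePoint e t))
      (Γ.height (Γ.parent e.1)) (Γ.height e.1)) {a c : ℝ} (ha : 0 ≤ a) (hc : a ≤ c) :
    HasACDeriv (fun t => (√(sphereAvg (fun x => ‖f x‖ ^ 2) t) : ℂ))
      (fun t => ((_root_.deriv (fun t => √(sphereAvg (fun x => ‖f x‖ ^ 2) t)) t : ℝ) : ℂ)) a c := by
  have key : ∀ n, HasACDeriv (fun t => (√(sphereAvg (fun x => ‖f x‖ ^ 2) t) : ℂ))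
      (fun t => ((_root_.deriv (fun t => √(sphereAvg (fun x => ‖f x‖ ^ 2) t)) t : ℝ) : ℂ))
      (h 0) (h n) := by
    intro n
    induction n with
    | zero =>
      refine ⟨by simp, fun t ht => ?_⟩
      rw [le_antisymm ht.2 ht.1]
      simp
    | succ n ih =>
      exact ih.trans (H.hasACDeriv_sqrt_sphereAvg_succ hac n).1 (H.strictMono.monotone (zero_le))
        (H.lt_succ n).le
  obtain ⟨-, ⟨n, rfl⟩, hn⟩ := not_bddAbove_iff.1 H.not_bddAbove c
  refine (key n).mono ?_ ?_
  · rw [H.zero]; exact ⟨ha, hc.trans hn.le⟩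
  · rw [H.zero]; exact ⟨ha.trans hc, hn.le⟩

theorem IsLeveled.abs_deriv_sqrt_sphereAvg_le (H : Γ.IsLeveled h b) {f f' : Γ.Point → ℂ}
    (hac : ∀ e : Γ.Edge, HasACDeriv (fun t => f (Γ.edgePoint e t)) (fun t => f' (Γ.edgePoint e t))
      (Γ.height (Γ.parent e.1)) (Γ.height e.1)) :
    ∀ᵐ t ∂volume.restrict (Ioi 0),
      |_root_.deriv (fun t => √(sphereAvg (fun x => ‖f x‖ ^ 2) t)) t| ≤
        √(sphereAvg (fun x => ‖f' x‖ ^ 2) t) := by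
  rw [← H.iUnion_Ioc]
  exact (ae_restrict_iUnion_iff _ _).2 fun n => (H.hasACDeriv_sqrt_sphereAvg_succ hac n).2

end MetricTree

/-! ### Integration and boundary behaviour on the half-line -/

theorem lintegral_halfLineMeasure {d : ℝ} (hd : 1 < d) (k : ℝ → ℝ≥0∞) :
    ∫⁻ t, k t ∂halfLineMeasure d =
      ∫⁻ t in Ioi 0, ENNReal.ofReal ((1 + t) ^ (d - 1)) * k t :=
  lintegral_withDensity_eq_lintegral_mul_non_measurable _
    (continuous_weight hd).measurable.ennreal_ofReal (ae_of_all _ fun _ => ENNReal.ofReal_lt_top) k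

theorem ae_halfLineMeasure_pos (d : ℝ) : ∀ᵐ t ∂halfLineMeasure d, 0 < t :=
  (withDensity_absolutelyContinuous _ _).ae_le (ae_restrict_mem measurableSet_Ioi)

/-- Elements of the weighted Sobolev space on the half-line extend continuously to `0`. -/
theorem exists_hasACDeriv_of_nonneg {d : ℝ} (hd : 1 < d) {f f' : ℝ → ℂ}
    (hf' : MemLp f' 2 (halfLineMeasure d)) (hac : ∀ a b, 0 < a → a < b → HasACDeriv f f' a b) :
    ∃ f₀ : ℝ → ℂ, (∀ t, 0 < t → f₀ t = f t) ∧ ∀ a b, 0 ≤ a → a ≤ b → HasACDeriv f₀ f' a b := by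
  -- The weight is at least one, so `f'` is square integrable, hence integrable, up to the endpoint
  -- `0`. The first edge of the tree needs this, being closed at the root.
  have hint : ∀ a b, 0 ≤ a → 0 ≤ b → IntervalIntegrable f' volume a b := by
    have h0 : ∀ c, 0 ≤ c → IntervalIntegrable f' volume 0 c := by
      intro c hc
      rw [intervalIntegrable_iff_integrableOn_Ioc_of_le hc]
      exact (hf'.mono_measure ((Measure.restrict_mono Ioc_subset_Ioi_self le_rfl).trans
        (restrict_Ioi_le_halfLineMeasure hd))).integrable (by norm_num)
    exact fun a b ha hb => (h0 a ha).symm.trans (h0 b hb)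
  refine ⟨fun t => f 1 + ∫ s in (1 : ℝ)..t, f' s, fun t ht => ?_, fun a b ha hab =>
    ⟨hint a b ha (ha.trans hab), fun t ht => ?_⟩⟩
  · change f 1 + _ = f t
    have h1 : (0 : ℝ) < min t 1 := lt_min ht one_pos
    have h2 : min t 1 ≤ 1 := min_le_right _ _
    have h3 := (hac (min t 1) (max t 1 + 1) h1
      (by linarith [le_max_right t 1])).sub_eq (s := 1) (t := t)
      ⟨h2, by linarith [le_max_right t 1]⟩ ⟨min_le_left _ _, by linarith [le_max_left t 1]⟩
    rw [← h3]; ring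
  · simp only
    rw [add_assoc, intervalIntegral.integral_add_adjacent_intervals (hint 1 a zero_le_one ha)
      (hint a t ha (ha.trans ht.1))]

namespace MetricTree.IsLeveled

universe u

variable {Γ : MetricTree.{u}} {h : ℕ → ℝ} {b : ℕ → ℕ} {d : ℝ}

/-! ## Comparison of the tree with the half-line -/

/-- Polar coordinates and the bound on the branching function. Comparing lower Lebesgue integrals
yields integrability together with the estimate. -/
theorem integral_le_of_sphereAvg_le (H : Γ.IsLeveled h b) (hd : 1 < d) {C : ℝ} (hC : 0 ≤ C)
    (hg : ∀ t, 0 ≤ t → (Γ.branchingFun t : ℝ) ≤ C * (1 + t) ^ (d - 1))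
    {F : Γ.Point → ℝ} {k : ℝ → ℝ} (hF : AEStronglyMeasurable F Γ.vol) (hF0 : ∀ x, 0 ≤ F x)
    (hk : Integrable k (halfLineMeasure d)) (hk0 : ∀ t, 0 ≤ k t)
    (hFk : ∀ᵐ t ∂volume.restrict (Ioi 0), sphereAvg F t ≤ k t) :
    Integrable F Γ.vol ∧ ∫ x, F x ∂Γ.vol ≤ C * ∫ t, k t ∂halfLineMeasure d := by
  have key : ∫⁻ x, ENNReal.ofReal (F x) ∂Γ.vol ≤
      ENNReal.ofReal (C * ∫ t, k t ∂halfLineMeasure d) := by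
    rw [ENNReal.ofReal_mul hC, ofReal_integral_eq_lintegral_ofReal hk (ae_of_all _ hk0),
      lintegral_halfLineMeasure hd, ← lintegral_const_mul' _ _ ENNReal.ofReal_ne_top,
      H.lintegral_vol_eq hF.aemeasurable hF0]
    refine lintegral_mono_ae ?_
    filter_upwards [hFk, ae_restrict_mem measurableSet_Ioi] with t ht ht0
    rw [← mul_assoc, ← ENNReal.ofReal_mul hC, ← ENNReal.ofReal_natCast]
    gcongr
    exact hg t (le_of_lt ht0)
  have hint : Integrable F Γ.vol := by
    rw [← lintegral_ofReal_ne_top_iff_integrable hF (ae_of_all _ hF0)]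
    exact (key.trans_lt ENNReal.ofReal_lt_top).ne
  refine ⟨hint, ?_⟩
  rw [← ofReal_integral_eq_lintegral_ofReal hint (ae_of_all _ hF0)] at key
  exact (ENNReal.ofReal_le_ofReal_iff (mul_nonneg hC (integral_nonneg hk0))).1 key

theorem integral_ge_of_le_sphereAvg (H : Γ.IsLeveled h b) (hd : 1 < d) {C : ℝ} (hC : 0 < C)
    (hg : ∀ t, 0 ≤ t → C * (1 + t) ^ (d - 1) ≤ (Γ.branchingFun t : ℝ))
    {F : Γ.Point → ℝ} {k : ℝ → ℝ} (hF : Integrable F Γ.vol) (hF0 : ∀ x, 0 ≤ F x)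
    (hk : AEStronglyMeasurable k (halfLineMeasure d)) (hk0 : ∀ t, 0 ≤ k t)
    (hFk : ∀ᵐ t ∂volume.restrict (Ioi 0), k t ≤ sphereAvg F t) :
    Integrable k (halfLineMeasure d) ∧ C * ∫ t, k t ∂halfLineMeasure d ≤ ∫ x, F x ∂Γ.vol := by
  have key : ENNReal.ofReal C * ∫⁻ t, ENNReal.ofReal (k t) ∂halfLineMeasure d ≤
      ENNReal.ofReal (∫ x, F x ∂Γ.vol) := by
    rw [ofReal_integral_eq_lintegral_ofReal hF (ae_of_all _ hF0), lintegral_halfLineMeasure hd,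
      ← lintegral_const_mul' _ _ ENNReal.ofReal_ne_top,
      H.lintegral_vol_eq hF.1.aemeasurable hF0]
    refine lintegral_mono_ae ?_
    filter_upwards [hFk, ae_restrict_mem measurableSet_Ioi] with t ht ht0
    rw [← mul_assoc, ← ENNReal.ofReal_mul hC.le, ← ENNReal.ofReal_natCast]
    gcongr
    exact hg t (le_of_lt ht0)
  have hint : Integrable k (halfLineMeasure d) := by
    rw [← lintegral_ofReal_ne_top_iff_integrable hk (ae_of_all _ hk0)]
    intro htop
    rw [htop, ENNReal.mul_top (ENNReal.ofReal_pos.2 hC).ne'] at key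
    exact ENNReal.ofReal_ne_top (top_le_iff.1 key)
  refine ⟨hint, ?_⟩
  rw [← ofReal_integral_eq_lintegral_ofReal hint (ae_of_all _ hk0),
    ← ENNReal.ofReal_mul hC.le] at key
  exact (ENNReal.ofReal_le_ofReal_iff (integral_nonneg hF0)).1 key

/-- Makes `f ∘ abs` almost everywhere strongly measurable on the tree when `f` is only so on the
half-line. In polar coordinates the preimage of a null set has measure zero. -/
theorem quasiMeasurePreserving_abs (H : Γ.IsLeveled h b) (hd : 1 < d) :
    Measure.QuasiMeasurePreserving (Point.abs : Γ.Point → ℝ) Γ.vol (halfLineMeasure d) := by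
  refine ⟨Γ.measurable_abs, Measure.AbsolutelyContinuous.mk fun s hs hs0 => ?_⟩
  have hpre := Γ.measurable_abs hs
  have h1 : ∀ᵐ t ∂volume.restrict (Ioi 0), t ∉ s :=
    measure_eq_zero_iff_ae_notMem.1
      (le_antisymm ((restrict_Ioi_le_halfLineMeasure hd s).trans hs0.le) zero_le)
  have hm : Measurable (s.indicator fun _ => (1 : ℝ)) := measurable_const.indicator hs
  have h2 := H.lintegral_vol_eq (F := fun x => s.indicator (fun _ => (1 : ℝ)) x.abs)
    (hm.comp Γ.measurable_abs).aemeasurable fun x => indicator_nonneg (fun _ _ => zero_le_one) _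
  rw [Measure.map_apply Γ.measurable_abs hs, ← lintegral_indicator_one hpre]
  have h3 : ∀ x : Γ.Point, (Point.abs ⁻¹' s).indicator (1 : Γ.Point → ℝ≥0∞) x =
      ENNReal.ofReal (s.indicator (fun _ => (1 : ℝ)) x.abs) := by
    intro x
    by_cases hx : x.abs ∈ s
    · rw [indicator_of_mem hx, indicator_of_mem (by exact hx)]; simp
    · rw [indicator_of_notMem hx, indicator_of_notMem (by exact hx)]; simp
  simp only [h3]
  rw [h2, lintegral_congr_ae (g := fun _ => 0), lintegral_zero]
  filter_upwards [h1, ae_restrict_mem measurableSet_Ioi] with t ht ht0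
  rw [H.sphereAvg_radial _ ht0, indicator_of_notMem ht]
  simp

variable {C₁ C₂ : ℝ} {V : ℝ → ℝ} {α l : ℝ}

/-- Lower bounds for the form on the tree give lower bounds for the form on the half-line, by
testing with radial functions. -/
theorem halfLine_bound_of_tree_bound (H : Γ.IsLeveled h b) (hd : 1 < d) (hC₁ : 0 < C₁)
    (hC₂ : 0 < C₂) (hg₁ : ∀ t, 0 ≤ t → C₁ * (1 + t) ^ (d - 1) ≤ (Γ.branchingFun t : ℝ))
    (hg₂ : ∀ t, 0 ≤ t → (Γ.branchingFun t : ℝ) ≤ C₂ * (1 + t) ^ (d - 1))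
    (hV : IsBoundedPotential V) (hα : 0 < α) (hl : l < 0)
    (hle : (l : EReal) ≤ infSpec (Γ.schrodingerOperator V hV α)) :
    (l : EReal) ≤ infSpec (halfLineOperator d V hV (α * (C₁ / C₂))) := by
  rw [H.le_infSpec_schrodingerOperator_iff] at hle
  rw [le_infSpec_halfLineOperator_iff hd]
  intro f f' hf hf' hac
  obtain ⟨f₀, hf₀, hac₀⟩ := exists_hasACDeriv_of_nonneg hd hf' hac
  have hff₀ : f =ᵐ[halfLineMeasure d] f₀ := by
    filter_upwards [ae_halfLineMeasure_pos d] with t ht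
    exact (hf₀ t ht).symm
  have hmf₀ : MemLp f₀ 2 (halfLineMeasure d) := (memLp_congr_ae hff₀).1 hf
  -- Nothing is known about `V` off `(0, ∞)`; the cutoff is nonnegative everywhere and agrees with
  -- `V` almost everywhere.
  set V₀ : ℝ → ℝ := (Ioi 0).indicator V with hV₀
  have hV₀0 : ∀ t, 0 ≤ V₀ t := fun t => indicator_nonneg (fun t ht => hV.nonneg t ht) t
  have hVV₀ : ∀ t, 0 < t → V t = V₀ t := fun t ht => (indicator_of_mem (by exact ht) V).symm
  have e1 : ∫ t, ‖f t‖ ^ 2 ∂halfLineMeasure d = ∫ t, ‖f₀ t‖ ^ 2 ∂halfLineMeasure d :=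
    integral_congr_ae (hff₀.mono fun t ht => by simp only [ht])
  have e2 : ∫ t, α * (C₁ / C₂) * V t * ‖f t‖ ^ 2 ∂halfLineMeasure d =
      C₁ / C₂ * ∫ t, α * V₀ t * ‖f₀ t‖ ^ 2 ∂halfLineMeasure d := by
    rw [← integral_const_mul]
    refine integral_congr_ae ?_
    filter_upwards [hff₀, ae_halfLineMeasure_pos d] with t ht ht0
    rw [ht, hVV₀ t ht0]; ring
  have hq := H.quasiMeasurePreserving_abs hd
  have i0 := (memLp_two_iff_integrable_sq_norm hmf₀.1).1 hmf₀
  have i1 := (memLp_two_iff_integrable_sq_norm hf'.1).1 hf'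
  have m0 : AEStronglyMeasurable (fun x : Γ.Point => f₀ x.abs) Γ.vol :=
    hmf₀.1.comp_quasiMeasurePreserving hq
  have m1 : AEStronglyMeasurable (fun x : Γ.Point => f' x.abs) Γ.vol :=
    hf'.1.comp_quasiMeasurePreserving hq
  have s0 : AEStronglyMeasurable (fun x : Γ.Point => ‖f₀ x.abs‖ ^ 2) Γ.vol := m0.norm.pow 2
  have s1 : AEStronglyMeasurable (fun x : Γ.Point => ‖f' x.abs‖ ^ 2) Γ.vol := m1.norm.pow 2
  have hrad : ∀ k : ℝ → ℝ, ∀ᵐ t ∂volume.restrict (Ioi 0),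
      sphereAvg (fun x : Γ.Point => k x.abs) t = k t := fun k => by
    filter_upwards [ae_restrict_mem measurableSet_Ioi] with t ht
    exact H.sphereAvg_radial k ht
  have c0 := H.integral_le_of_sphereAvg_le hd hC₂.le hg₂ (F := fun x => ‖f₀ x.abs‖ ^ 2)
    s0 (fun _ => sq_nonneg _) i0 (fun _ => sq_nonneg _)
    ((hrad fun t => ‖f₀ t‖ ^ 2).mono fun t ht => ht.le)
  have c1 := H.integral_le_of_sphereAvg_le hd hC₂.le hg₂ (F := fun x => ‖f' x.abs‖ ^ 2)
    s1 (fun _ => sq_nonneg _) i1 (fun _ => sq_nonneg _)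
    ((hrad fun t => ‖f' t‖ ^ 2).mono fun t ht => ht.le)
  have hVae : (fun x : Γ.Point => α * V x.abs * ‖f₀ x.abs‖ ^ 2) =ᵐ[Γ.vol]
      fun x => α * V₀ x.abs * ‖f₀ x.abs‖ ^ 2 := by
    filter_upwards [Γ.ae_abs_pos] with x hx
    rw [hVV₀ _ hx]
  have i2 : Integrable (fun x : Γ.Point => α * V₀ x.abs * ‖f₀ x.abs‖ ^ 2) Γ.vol :=
    (Integrable.mul_of_top_right c0.1 (Γ.memLp_radial hV α)).congr hVae
  have s2 : AEStronglyMeasurable (fun t => ‖f₀ t‖ ^ 2) (halfLineMeasure d) := hmf₀.1.norm.pow 2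
  have m2 : AEStronglyMeasurable (fun t => α * V₀ t * ‖f₀ t‖ ^ 2) (halfLineMeasure d) :=
    ((hV.measurable_indicator.const_mul α).aestronglyMeasurable).mul s2
  -- Norm and energy were bounded above with `C₂`; the potential, which enters the form with a minus
  -- sign, is bounded below with `C₁`. The quotient is the coupling factor.
  have c2 := H.integral_ge_of_le_sphereAvg hd hC₁ hg₁ i2
    (fun x => mul_nonneg (mul_nonneg hα.le (hV₀0 _)) (sq_nonneg _)) m2
    (fun t => mul_nonneg (mul_nonneg hα.le (hV₀0 _)) (sq_nonneg _))
    ((hrad fun t => α * V₀ t * ‖f₀ t‖ ^ 2).mono fun t ht => ht.ge)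
  have hmain := hle (fun x => f₀ x.abs) (fun x => f' x.abs)
    ((memLp_two_iff_integrable_sq_norm m0).2 c0.1) ((memLp_two_iff_integrable_sq_norm m1).2 c1.1)
    fun e => by
      have hpos : 0 ≤ Γ.height (Γ.parent e.1) := by rw [H.height]; exact H.nonneg _
      refine (hac₀ _ _ hpos (height_parent_lt e).le).congr (height_parent_lt e).le
        (fun t ht => by rw [abs_edgePoint ht]) ?_
      filter_upwards [ae_restrict_mem measurableSet_Ioc] with t ht
      rw [abs_edgePoint (Ioc_subset_Icc_self ht)]
  rw [integral_congr_ae hVae] at hmain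
  rw [e1, e2]
  -- Negativity of `l` reverses the norm estimate into the required direction.
  have h1 := mul_le_mul_of_nonpos_left c0.2 hl.le
  have h2 : C₂ * (C₁ / C₂ * ∫ t, α * V₀ t * ‖f₀ t‖ ^ 2 ∂halfLineMeasure d) =
      C₁ * ∫ t, α * V₀ t * ‖f₀ t‖ ^ 2 ∂halfLineMeasure d := by
    field_simp
  refine le_of_mul_le_mul_left ?_ hC₂
  rw [mul_sub, h2]
  linarith [c1.2, c2.2]

/-- Lower bounds for the form on the half-line give lower bounds for the form on the tree, by
testing with the root mean square over spheres of a function on the tree. -/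
theorem tree_bound_of_halfLine_bound (H : Γ.IsLeveled h b) (hd : 1 < d) (hC₁ : 0 < C₁)
    (hC₂ : 0 < C₂) (hg₁ : ∀ t, 0 ≤ t → C₁ * (1 + t) ^ (d - 1) ≤ (Γ.branchingFun t : ℝ))
    (hg₂ : ∀ t, 0 ≤ t → (Γ.branchingFun t : ℝ) ≤ C₂ * (1 + t) ^ (d - 1))
    (hV : IsBoundedPotential V) (hα : 0 < α) (hl : l < 0)
    (hle : (l : EReal) ≤ infSpec (halfLineOperator d V hV (α * (C₂ / C₁)))) :
    (l : EReal) ≤ infSpec (Γ.schrodingerOperator V hV α) := by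
  rw [le_infSpec_halfLineOperator_iff hd] at hle
  rw [H.le_infSpec_schrodingerOperator_iff]
  intro f f' hf hf' hac
  set φ : ℝ → ℝ := fun t => √(sphereAvg (fun x => ‖f x‖ ^ 2) t) with hφ
  have hsq : ∀ (k : Γ.Point → ℂ) (t : ℝ),
      √(sphereAvg (fun x => ‖k x‖ ^ 2) t) ^ 2 = sphereAvg (fun x => ‖k x‖ ^ 2) t := fun k t =>
    Real.sq_sqrt (sphereAvg_nonneg (fun _ => sq_nonneg _) t)
  have hφac : ∀ a c, 0 ≤ a → a ≤ c → HasACDeriv (fun t => (φ t : ℂ))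
      (fun t => ((_root_.deriv φ t : ℝ) : ℂ)) a c := fun a c ha hc =>
    H.hasACDeriv_sqrt_sphereAvg hac ha hc
  have hφ' := H.abs_deriv_sqrt_sphereAvg_le hac
  have hcont : ContinuousOn φ (Ioi 0) := by
    intro t ht
    have ht0 : (0 : ℝ) < t := ht
    have h1 := ((hφac 0 (t + 1) le_rfl (by linarith)).continuousOn (by linarith)).continuousAt
      (Icc_mem_nhds ht0 (lt_add_one t))
    have h2 : ContinuousAt (fun s => ((φ s : ℂ)).re) t := Complex.continuous_re.continuousAt.comp h1
    exact h2.continuousWithinAt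
  have hmφ : AEStronglyMeasurable φ (halfLineMeasure d) :=
    (hcont.aestronglyMeasurable measurableSet_Ioi).mono_ac (withDensity_absolutelyContinuous _ _)
  have hmφ' : Measurable (_root_.deriv φ) := measurable_deriv φ
  set V₀ : ℝ → ℝ := (Ioi 0).indicator V with hV₀
  have hV₀0 : ∀ t, 0 ≤ V₀ t := fun t => indicator_nonneg (fun t ht => hV.nonneg t ht) t
  have hVV₀ : ∀ t, 0 < t → V t = V₀ t := fun t ht => (indicator_of_mem (by exact ht) V).symm
  have i0 := (memLp_two_iff_integrable_sq_norm hf.1).1 hf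
  have i1 := (memLp_two_iff_integrable_sq_norm hf'.1).1 hf'
  have s0 : AEStronglyMeasurable (fun t => φ t ^ 2) (halfLineMeasure d) := hmφ.pow 2
  have s1 : AEStronglyMeasurable (fun t => _root_.deriv φ t ^ 2) (halfLineMeasure d) :=
    (hmφ'.pow_const 2).aestronglyMeasurable
  have s2 : AEStronglyMeasurable (fun x => ‖f x‖ ^ 2) Γ.vol := hf.1.norm.pow 2
  have c0 := H.integral_ge_of_le_sphereAvg hd hC₁ hg₁ i0 (fun _ => sq_nonneg _) s0
    (fun _ => sq_nonneg _) (ae_of_all _ fun t => (hsq f t).le)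
  -- The derivative bound for the root mean square enters here: its energy, times `C₁`, is at most
  -- the energy of `f`.
  have c1 := H.integral_ge_of_le_sphereAvg hd hC₁ hg₁ i1 (fun _ => sq_nonneg _) s1 (fun _ => sq_nonneg _) (by
      filter_upwards [hφ'] with t ht
      rw [← hsq f' t, ← sq_abs]
      gcongr)
  have hVae : (fun t => α * V t * φ t ^ 2) =ᵐ[halfLineMeasure d] fun t => α * V₀ t * φ t ^ 2 := by
    filter_upwards [ae_halfLineMeasure_pos d] with t ht
    rw [hVV₀ _ ht]
  have i2 : Integrable (fun t => α * V₀ t * φ t ^ 2) (halfLineMeasure d) :=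
    (Integrable.mul_of_top_right c0.1 (hV.memLp_halfLine d α)).congr hVae
  have hVm : Measurable fun x : Γ.Point => α * V₀ x.abs :=
    (hV.measurable_indicator.comp Γ.measurable_abs).const_mul α
  have m2 : AEStronglyMeasurable (fun x : Γ.Point => α * V₀ x.abs * ‖f x‖ ^ 2) Γ.vol :=
    hVm.aestronglyMeasurable.mul s2
  have c2 := H.integral_le_of_sphereAvg_le hd hC₂.le hg₂ m2 (fun x => mul_nonneg (mul_nonneg hα.le (hV₀0 _)) (sq_nonneg _)) i2
    (fun t => mul_nonneg (mul_nonneg hα.le (hV₀0 _)) (sq_nonneg _)) (by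
      filter_upwards [ae_restrict_mem measurableSet_Ioi] with t ht
      rw [H.sphereAvg_radial_mul (fun t => α * V₀ t) _ ht, ← hsq f t])
  have n0 : ∀ t, ‖(φ t : ℂ)‖ ^ 2 = φ t ^ 2 := fun t => by
    rw [Complex.norm_real, Real.norm_eq_abs, sq_abs]
  have n1 : ∀ t, ‖((_root_.deriv φ t : ℝ) : ℂ)‖ ^ 2 = _root_.deriv φ t ^ 2 := fun t => by
    rw [Complex.norm_real, Real.norm_eq_abs, sq_abs]
  have m1 : AEStronglyMeasurable (fun t => ((_root_.deriv φ t : ℝ) : ℂ)) (halfLineMeasure d) :=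
    (Complex.measurable_ofReal.comp hmφ').aestronglyMeasurable
  have hmain := hle (fun t => (φ t : ℂ)) (fun t => ((_root_.deriv φ t : ℝ) : ℂ))
    ((memLp_two_iff_integrable_sq_norm
      (Complex.continuous_ofReal.comp_aestronglyMeasurable hmφ)).2 (by simpa only [n0] using c0.1))
    ((memLp_two_iff_integrable_sq_norm m1).2 (by simpa only [n1] using c1.1))
    fun a c ha hac => hφac a c ha.le hac.le
  simp only [n0, n1] at hmain
  have e1 : ∫ x : Γ.Point, α * V x.abs * ‖f x‖ ^ 2 ∂Γ.vol =
      ∫ x : Γ.Point, α * V₀ x.abs * ‖f x‖ ^ 2 ∂Γ.vol := by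
    refine integral_congr_ae ?_
    filter_upwards [Γ.ae_abs_pos] with x hx
    rw [hVV₀ _ hx]
  have e2 : ∫ t, α * (C₂ / C₁) * V t * φ t ^ 2 ∂halfLineMeasure d =
      C₂ / C₁ * ∫ t, α * V₀ t * φ t ^ 2 ∂halfLineMeasure d := by
    rw [← integral_const_mul]
    refine integral_congr_ae ?_
    filter_upwards [ae_halfLineMeasure_pos d] with t ht0
    rw [hVV₀ t ht0]; ring
  rw [e2] at hmain
  rw [e1]
  -- Here the norm on the tree is bounded below by `C₁` times that of `φ`, again usable because `l <
  -- 0`.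
  have h1 := mul_le_mul_of_nonpos_left c0.2 hl.le
  have h2 : C₁ * (C₂ / C₁ * ∫ t, α * V₀ t * φ t ^ 2 ∂halfLineMeasure d) =
      C₂ * ∫ t, α * V₀ t * φ t ^ 2 ∂halfLineMeasure d := by
    field_simp
  have h3 := mul_le_mul_of_nonneg_left hmain hC₁.le
  rw [mul_sub, h2] at h3
  linarith [c1.2, c2.2]

end MetricTree.IsLeveled

end TreeSchrodinger

/-! ### Conclusion -/

open TreeSchrodinger
theorem lemma4p1 (Γ : MetricTree) (hΓ : Γ.IsProper) (hreg : Γ.IsRegular)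
    (d : ℝ) (hd1 : 1 < d) (hd2 : d ≤ 2)
    (C₁ C₂ : ℝ) (hC₁ : 0 < C₁) (hC₂ : 0 < C₂)
    (hdim : ∀ t : ℝ, 0 ≤ t →
      C₁ * (1 + t) ^ (d - 1) ≤ (Γ.branchingFun t : ℝ) ∧
        (Γ.branchingFun t : ℝ) ≤ C₂ * (1 + t) ^ (d - 1))
    (V : ℝ → ℝ) (hV : IsBoundedPotential V)
    (α : ℝ) (hα : 0 < α)
    (hneg : infSpec (halfLineOperator d V hV (α * (C₁ / C₂))) < 0) :
    infSpec (halfLineOperator d V hV (α * (C₂ / C₁))) ≤ infSpec (Γ.schrodingerOperator V hV α) ∧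
      infSpec (Γ.schrodingerOperator V hV α) ≤ infSpec (halfLineOperator d V hV (α * (C₁ / C₂))) := by
  have hpos : ∀ t, 0 ≤ t → 0 < Γ.branchingFun t := fun t ht => by
    have h1 : 0 < C₁ * (1 + t) ^ (d - 1) := mul_pos hC₁ (Real.rpow_pos_of_pos (by linarith) _)
    exact_mod_cast h1.trans_le (hdim t ht).1
  obtain ⟨h, b, H⟩ := MetricTree.exists_isLeveled hΓ hreg hpos
  have hg₁ := fun t ht => (hdim t ht).1
  have hg₂ := fun t ht => (hdim t ht).2
  have upper : infSpec (Γ.schrodingerOperator V hV α) ≤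
      infSpec (halfLineOperator d V hV (α * (C₁ / C₂))) := by
    by_contra hlt
    -- Since the form comparison needs a real `l < 0`, the separating value is taken below the
    -- minimum of the larger infimum and `0`. Finiteness of the infima is never needed.
    obtain ⟨l, hl1, hl2⟩ := EReal.lt_iff_exists_real_btwn.1 (lt_min (not_le.1 hlt) hneg)
    have hl0 : l < 0 := by exact_mod_cast hl2.trans_le (min_le_right _ _)
    exact absurd (H.halfLine_bound_of_tree_bound hd1 hC₁ hC₂ hg₁ hg₂ hV hα hl0
      (hl2.le.trans (min_le_left _ _))) (not_le.2 hl1)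
  refine ⟨?_, upper⟩
  by_contra hlt
  obtain ⟨l, hl1, hl2⟩ :=
    -- The upper bound just proved makes the bottom of the tree spectrum negative, so a violation of
    -- the lower bound again has a negative separating value.
    EReal.lt_iff_exists_real_btwn.1 (lt_min (not_le.1 hlt) (upper.trans_lt hneg))
  have hl0 : l < 0 := by exact_mod_cast hl2.trans_le (min_le_right _ _)
  exact absurd (H.tree_bound_of_halfLine_bound hd1 hC₁ hC₂ hg₁ hg₂ hV hα hl0
    (hl2.le.trans (min_le_left _ _))) (not_le.2 hl1)
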